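/- Let $M$ be a connected (Hausdorff) smooth manifold with $\dim M=2n+s$, $s\ge 1$, and let $(\varphi,\xi_\alpha,\eta^\alpha,g)$, $\alpha\in\{1,\dots,s\}$, be a Lorentzian $\mathcal S$-structure on $M$, that is: * $\varphi$ is a nowhere vanishing smooth $(1,1)$-tensor field, $\xi_1,\dots,\xi_s$ are smooth vector fields and $\eta^1,\dots,\eta^s$ smooth $1$-forms with $\varphi^2=-I+\sum_\alpha\eta^\alpha\otimes\xi_\alpha$ and $\eta^\alpha(\xi_\beta)=\delta^\alpha_\beta$; * $g$ is a smooth Lorentzian metric (signature $(2n+s-1,1)$) with $g(\varphi X,\varphi Y)=g(X,Y)-\sum_\alpha\varepsilon_\alpha\eta^\alpha(X)\eta^\alpha(Y)$, where $\varepsilon_\alpha=g(\xi_\alpha,\xi_\alpha)=\pm1$, the timelike characteristic vector field being $\xi_1$, i.e. $g(\xi_1,\xi_1)=-1$; * $g(X,\varphi Y)=d\eta^\alpha(X,Y)$ for every $\alpha$, where $2\,d\eta(X,Y)=X(\eta(Y))-Y(\eta(X))-\eta([X,Y])$; * $[\varphi,\varphi]+2\sum_\alpha d\eta^\alpha\otimes\xi_\alpha=0$,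 where $[\varphi,\varphi](X,Y)=\varphi^2[X,Y]+[\varphi X,\varphi Y]-\varphi[\varphi X,Y]-\varphi[X,\varphi Y]$. Let $R(X,Y)Z=\nabla_X\nabla_YZ-\nabla_Y\nabla_XZ-\nabla_{[X,Y]}Z$ be the curvature of the Levi-Civita connection of $g$. Fix $p\in M$. Let $$S_\varphi((\xi_1)_p)=\{x\in\mathrm{Im}(\varphi_p) : g_p(x,(\xi_1)_p)=0,\ g_p(x,x)=1\}$$ be the $\varphi$-celestial sphere, and let $$N_\varphi((\xi_1)_p)=\{u\in T_pM : g_p(u,u)=0,\ g_p(u,(\xi_1)_p)=-1,\ u-(\xi_1)_p\in S_\varphi((\xi_1)_p)\}.$$ For $x\in S_\varphi((\xi_1)_p)$ let $R_x\colon x^\perp\to x^\perp$, $R_x(y)=R_p(y,x)x$. For $u\in N_\varphi((\xi_1)_p)$ let $\bar R_u$ be the endomorphism of $u^\perp/\mathrm{span}(u)$ induced by $y\mapsto R_p(y,u)u$. One says that $M$ is $\varphi$-null Osserman with respect to $(\xi_1)_p$ if the eigenvalues of $\bar R_u$, with their multiplicities, do not depend on $u\in N_\varphi((\xi_1)_p)$.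 Here the eigenvalues with multiplicities of an endomorphism are the (complex) roots of its characteristic polynomial with their multiplicities. Then $M$ is $\varphi$-null Osserman with respect to $(\xi_1)_p$ if and only if the eigenvalues of $R_x$, with their multiplicities, do not depend on $x\in S_\varphi((\xi_1)_p)$. -/

import Mathlib

open Bundle Manifold ContDiff Topology

namespace LorentzS

noncomputable section

/-! ### Tensor calculus on the model space

Tensor fields in coordinates are functions on the model space `E`, differentiated with `fderiv`. -/

section Coordinates

variable {E : Type*} [NormedAddCommGroup E] [NormedSpace ℝ E]

/-- The covector `z ↦ (∂_v G)(w, z) + (∂_w G)(v, z) - (∂_z G)(v, w)` of a field `G` of bilinear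
forms: twice the Christoffel symbols of the first kind. -/
def koszul (G : E → E →L[ℝ] E →L[ℝ] ℝ) (x v w : E) : E →L[ℝ] ℝ :=
  fderiv ℝ (fun y ↦ G y w) x v + fderiv ℝ (fun y ↦ G y v) x w - fderiv ℝ (fun y ↦ G y v w) x

/-- The Christoffel symbols (of the second kind) of `G`: the vector `Γ(v, w)` with
`2 G(Γ(v, w), z) = (∂_v G)(w, z) + (∂_w G)(v, z) - (∂_z G)(v, w)` for all `z`. Here `G x` is seen
as the map `E → E*` lowering an index; it is invertible when `G x` is nondegenerate. -/
def christoffel (G : E → E →L[ℝ] E →L[ℝ] ℝ) (x v w : E) : E :=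
  (G x).inverse ((1 / 2 : ℝ) • koszul G x v w)

/-- The Levi-Civita covariant derivative `∇_X Y` of `G` in coordinates. -/
def covDeriv (G : E → E →L[ℝ] E →L[ℝ] ℝ) (X Y : E → E) (x : E) : E :=
  fderiv ℝ Y x (X x) + christoffel G x (X x) (Y x)

/-- The curvature operator `R(X, Y) Z = ∇_X ∇_Y Z - ∇_Y ∇_X Z - ∇_[X, Y] Z` in coordinates,
evaluated on the constant vector fields `X = a`, `Y = b`, `Z = c`. -/
def coordCurvature (G : E → E →L[ℝ] E →L[ℝ] ℝ) (x a b c : E) : E :=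
  covDeriv G (fun _ ↦ a) (covDeriv G (fun _ ↦ b) (fun _ ↦ c)) x
    - covDeriv G (fun _ ↦ b) (covDeriv G (fun _ ↦ a) (fun _ ↦ c)) x
    - covDeriv G (VectorField.lieBracket ℝ (fun _ ↦ a) (fun _ ↦ b)) (fun _ ↦ c) x

/-- The exterior derivative of a 1-form in coordinates, with the normalization
`2 dη(X, Y) = X(η(Y)) - Y(η(X)) - η([X, Y])`, evaluated on the constant vector fields `X = v`,
`Y = w`. -/
def coordExtDeriv (η : E → E →L[ℝ] ℝ) (x v w : E) : ℝ :=
  (1 / 2 : ℝ) * (fderiv ℝ (fun y ↦ η y w) x v - fderiv ℝ (fun y ↦ η y v) x w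
    - η x (VectorField.lieBracket ℝ (fun _ ↦ v) (fun _ ↦ w) x))

/-- The Nijenhuis tensor `φ²[X, Y] + [φX, φY] - φ[φX, Y] - φ[X, φY]` of a field `φ` of
endomorphisms in coordinates, evaluated on the constant vector fields `X = v`, `Y = w`. -/
def coordNijenhuis (φ : E → E →L[ℝ] E) (x v w : E) : E :=
  φ x (φ x (VectorField.lieBracket ℝ (fun _ ↦ v) (fun _ ↦ w) x))
    + VectorField.lieBracket ℝ (fun y ↦ φ y v) (fun y ↦ φ y w) x
    - φ x (VectorField.lieBracket ℝ (fun y ↦ φ y v) (fun _ ↦ w) x)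
    - φ x (VectorField.lieBracket ℝ (fun _ ↦ v) (fun y ↦ φ y w) x)

theorem lieBracket_const (a b : E) :
    VectorField.lieBracket ℝ (fun _ : E ↦ a) (fun _ ↦ b) = fun _ ↦ 0 := by
  ext x; simp [VectorField.lieBracket]

variable {G : E → E →L[ℝ] E →L[ℝ] ℝ} {x : E}

theorem fderiv_apply₁ (hd : DifferentiableAt ℝ G x) (v a : E) :
    fderiv ℝ (fun y ↦ G y v) x a = fderiv ℝ G x a v := by
  rw [(hd.hasFDerivAt.clm_apply (hasFDerivAt_const v x)).fderiv]; simp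

theorem fderiv_apply₂ (hd : DifferentiableAt ℝ G x) (v w a : E) :
    fderiv ℝ (fun y ↦ G y v w) x a = fderiv ℝ G x a v w := by
  rw [((hd.hasFDerivAt.clm_apply (hasFDerivAt_const v x)).clm_apply
    (hasFDerivAt_const w x)).fderiv]; simp

theorem koszul_apply (hd : DifferentiableAt ℝ G x) (v w z : E) :
    koszul G x v w z = fderiv ℝ G x v w z + fderiv ℝ G x w v z - fderiv ℝ G x z v w := by
  simp [koszul, fderiv_apply₁ hd, fderiv_apply₂ hd]

theorem christoffel_spec (hi : (G x).IsInvertible) (v w z : E) :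
    G x (christoffel G x v w) z = (1 / 2 : ℝ) * koszul G x v w z := by
  have : G x (christoffel G x v w) = (1 / 2 : ℝ) • koszul G x v w :=
    ((hi.inverse_apply_eq).1 rfl).symm
  rw [this]; rfl

set_option synthInstance.maxHeartbeats 200000 in
theorem christoffel_add_left (hd : DifferentiableAt ℝ G x) (v v' w : E) :
    christoffel G x (v + v') w = christoffel G x v w + christoffel G x v' w := by
  have : koszul G x (v + v') w = koszul G x v w + koszul G x v' w := by
    ext z; simp [koszul_apply hd]; ring
  simp only [christoffel, this, smul_add, map_add]

set_option synthInstance.maxHeartbeats 200000 in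
theorem christoffel_smul_left (hd : DifferentiableAt ℝ G x) (r : ℝ) (v w : E) :
    christoffel G x (r • v) w = r • christoffel G x v w := by
  have : koszul G x (r • v) w = r • koszul G x v w := by
    ext z; simp [koszul_apply hd]; ring
  simp only [christoffel, this, smul_comm _ r, map_smul]

theorem christoffel_symm (hs : ∀ y v w, G y v w = G y w v) (v w : E) :
    christoffel G x v w = christoffel G x w v := by
  have : (fun y ↦ G y v w) = fun y ↦ G y w v := funext fun y ↦ hs y v w
  simp only [christoffel, koszul, this, add_comm]

theorem christoffel_zero_left (w : E) : christoffel G x 0 w = 0 := by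
  have : koszul G x 0 w = 0 := by simp [koszul]
  simp [christoffel, this]

/-- The classical expression of the curvature through the Christoffel symbols. -/
theorem coordCurvature_eq (a b c : E) :
    coordCurvature G x a b c =
      fderiv ℝ (fun y ↦ christoffel G y b c) x a + christoffel G x a (christoffel G x b c)
        - (fderiv ℝ (fun y ↦ christoffel G y a c) x b
          + christoffel G x b (christoffel G x a c)) := by
  have h : ∀ b c : E, covDeriv G (fun _ ↦ b) (fun _ ↦ c) = fun y ↦ christoffel G y b c := by
    intro b c; ext y; simp [covDeriv]
  simp only [coordCurvature, lieBracket_const, h]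
  simp [covDeriv, christoffel_zero_left]

/-- Metric compatibility of the Christoffel symbols. -/
theorem fderiv_eq_christoffel (hs : ∀ y v w, G y v w = G y w v) (hd : DifferentiableAt ℝ G x)
    (hi : (G x).IsInvertible) (a b c : E) :
    fderiv ℝ (fun y ↦ G y b c) x a = G x (christoffel G x a b) c + G x b (christoffel G x a c) := by
  have hsym : ∀ z v w, fderiv ℝ G x z v w = fderiv ℝ G x z w v := by
    intro z v w
    rw [← fderiv_apply₂ hd, ← fderiv_apply₂ hd]
    simp only [hs _ v w]
  rw [hs x b, christoffel_spec hi, christoffel_spec hi, koszul_apply hd, koszul_apply hd,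
    hsym b a c, hsym c a b, fderiv_apply₂ hd, hsym a c b]
  ring

theorem eventually_differentiableAt (hd : ContDiffAt ℝ 2 G x) :
    ∀ᶠ y in 𝓝 x, DifferentiableAt ℝ G y := by
  filter_upwards [hd.eventually (by simp)] with y hy using hy.differentiableAt (by simp)

section Smooth

variable [CompleteSpace E]

theorem eventually_isInvertible (hc : ContinuousAt G x) (hi : (G x).IsInvertible) :
    ∀ᶠ y in 𝓝 x, (G y).IsInvertible := by
  obtain ⟨e, he⟩ := hi
  have := hc.eventually (he ▸ ContinuousLinearEquiv.nhds e)
  filter_upwards [this] with y hy using hy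

theorem differentiableAt_christoffel (hd : ContDiffAt ℝ 2 G x) (hi : (G x).IsInvertible)
    (v w : E) : DifferentiableAt ℝ (fun y ↦ christoffel G y v w) x := by
  have hinv : DifferentiableAt ℝ (fun y ↦ (G y).inverse) x :=
    ((hi.contDiffAt_map_inverse (n := 1)).differentiableAt (by simp)).comp x
      (hd.differentiableAt (by simp))
  have h1 : ∀ v : E, ContDiffAt ℝ 2 (fun y ↦ G y v) x := fun v ↦ hd.clm_apply contDiffAt_const
  have h2 : ContDiffAt ℝ 2 (fun y ↦ G y v w) x := (h1 v).clm_apply contDiffAt_const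
  have h3 : ∀ v w : E, DifferentiableAt ℝ (fun y ↦ fderiv ℝ (fun y ↦ G y v) y w) x := fun v w ↦
    (((h1 v).fderiv_right (m := 1) (by norm_num)).clm_apply contDiffAt_const).differentiableAt
      (by simp)
  have h4 : DifferentiableAt ℝ (fun y ↦ fderiv ℝ (fun y ↦ G y v w) y) x :=
    (h2.fderiv_right (m := 1) (by norm_num)).differentiableAt (by simp)
  exact hinv.clm_apply ((((h3 w v).add (h3 v w)).sub h4).const_smul (1 / 2 : ℝ))

theorem coordCurvature_add (hs : ∀ y v w, G y v w = G y w v) (hd : ContDiffAt ℝ 2 G x)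
    (hi : (G x).IsInvertible) (a a' b c : E) :
    coordCurvature G x (a + a') b c = coordCurvature G x a b c + coordCurvature G x a' b c := by
  have hdx : DifferentiableAt ℝ G x := hd.differentiableAt (by simp)
  have h : (fun y ↦ christoffel G y (a + a') c) =ᶠ[𝓝 x]
      (fun y ↦ christoffel G y a c) + fun y ↦ christoffel G y a' c := by
    filter_upwards [eventually_differentiableAt hd] with y hy
    exact christoffel_add_left hy a a' c
  rw [coordCurvature_eq, coordCurvature_eq, coordCurvature_eq, h.fderiv_eq,
    fderiv_add (differentiableAt_christoffel hd hi a c) (differentiableAt_christoffel hd hi a' c),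
    christoffel_add_left hdx, christoffel_add_left hdx, christoffel_symm hs b (_ + _),
    christoffel_add_left hdx, christoffel_symm hs b (christoffel G x a c),
    christoffel_symm hs b (christoffel G x a' c)]
  simp
  abel

theorem coordCurvature_smul (hs : ∀ y v w, G y v w = G y w v) (hd : ContDiffAt ℝ 2 G x)
    (hi : (G x).IsInvertible) (r : ℝ) (a b c : E) :
    coordCurvature G x (r • a) b c = r • coordCurvature G x a b c := by
  have hdx : DifferentiableAt ℝ G x := hd.differentiableAt (by simp)
  have h : (fun y ↦ christoffel G y (r • a) c) =ᶠ[𝓝 x] r • fun y ↦ christoffel G y a c := by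
    filter_upwards [eventually_differentiableAt hd] with y hy
    exact christoffel_smul_left hy r a c
  rw [coordCurvature_eq, coordCurvature_eq, h.fderiv_eq,
    fderiv_const_smul (differentiableAt_christoffel hd hi a c),
    christoffel_smul_left hdx, christoffel_smul_left hdx, christoffel_symm hs b (r • _),
    christoffel_smul_left hdx, christoffel_symm hs b (christoffel G x a c)]
  simp [smul_sub]

/-- Skew-symmetry of the curvature: `G(R(a, b) c, c) = 0`. -/
theorem coordCurvature_skew (hs : ∀ y v w, G y v w = G y w v) (hd : ContDiffAt ℝ 2 G x)
    (hi : (G x).IsInvertible) (a b c : E) : G x (coordCurvature G x a b c) c = 0 := by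
  have hdx : DifferentiableAt ℝ G x := hd.differentiableAt (by simp)
  have hF : ContDiffAt ℝ 2 (fun y ↦ G y c c) x :=
    (hd.clm_apply contDiffAt_const).clm_apply contDiffAt_const
  have hF' : DifferentiableAt ℝ (fderiv ℝ fun y ↦ G y c c) x :=
    (hF.fderiv_right (m := 1) (by norm_num)).differentiableAt (by simp)
  have hF1 : ∀ b, (fun y ↦ fderiv ℝ (fun y ↦ G y c c) y b) =ᶠ[𝓝 x]
      fun y ↦ 2 * G y (christoffel G y b c) c := by
    intro b
    filter_upwards [eventually_isInvertible hd.continuousAt hi, eventually_differentiableAt hd]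
      with y h1 h2
    rw [fderiv_eq_christoffel hs h2 h1, hs y c]; ring
  have hF2 : ∀ a b, fderiv ℝ (fderiv ℝ fun y ↦ G y c c) x a b =
      2 * (G x (christoffel G x a (christoffel G x b c)) c
        + G x (christoffel G x b c) (christoffel G x a c)
        + G x (fderiv ℝ (fun y ↦ christoffel G y b c) x a) c) := by
    intro a b
    have h1 := hF'.hasFDerivAt.clm_apply (hasFDerivAt_const b x)
    have h2 := (hdx.hasFDerivAt.clm_apply
      (differentiableAt_christoffel hd hi b c).hasFDerivAt).clm_apply (hasFDerivAt_const c x)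
    have h3 := (hF1 b).fderiv_eq (𝕜 := ℝ)
    rw [h1.fderiv, (h2.const_mul 2).fderiv] at h3
    have h4 := congrArg (fun L ↦ L a) h3
    simp at h4
    rw [h4, ← fderiv_apply₂ hdx, fderiv_eq_christoffel hs hdx hi]
    ring
  have h5 := (hF.isSymmSndFDerivAt (by simp)).eq a b
  rw [hF2, hF2, hs x (christoffel G x a c) (christoffel G x b c)] at h5
  simp only [coordCurvature_eq, map_add, map_sub, add_apply, sub_apply]
  linarith

end Smooth

end Coordinates

/-! ### Smooth manifolds: tensor fields, metrics, curvature -/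

section Manifold

variable {E : Type*} [NormedAddCommGroup E] [NormedSpace ℝ E] [FiniteDimensional ℝ E]
  {M : Type*} [TopologicalSpace M] [ChartedSpace E M] [IsManifold 𝓘(ℝ, E) ∞ M]

/-- The coordinate frame at `q` of the preferred chart around `p`: the differential at (the image
of) `q` of the inverse of that chart (see `TangentBundle.symmL_trivializationAt`). -/
def frame (p q : M) : E →L[ℝ] TangentSpace 𝓘(ℝ, E) q :=
  (trivializationAt E (TangentSpace 𝓘(ℝ, E)) p).symmL ℝ q

/-- The coordinates at `q` of tangent vectors in the preferred chart around `p`: the differential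
at `q` of that chart (see `TangentBundle.continuousLinearMapAt_trivializationAt`). -/
def coframe (p q : M) : TangentSpace 𝓘(ℝ, E) q →L[ℝ] E :=
  (trivializationAt E (TangentSpace 𝓘(ℝ, E)) p).continuousLinearMapAt ℝ q

/-- A smooth Lorentzian metric: a smooth field of symmetric bilinear forms of signature
`(dim M - 1, 1)`, i.e. such that some vector is timelike with positive definite orthogonal
complement. -/
structure LorentzMetric (E : Type*) [NormedAddCommGroup E] [NormedSpace ℝ E]
    [FiniteDimensional ℝ E] (M : Type*) [TopologicalSpace M] [ChartedSpace E M]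
    [IsManifold 𝓘(ℝ, E) ∞ M] where
  form (q : M) : TangentSpace 𝓘(ℝ, E) q →L[ℝ] TangentSpace 𝓘(ℝ, E) q →L[ℝ] ℝ
  smooth : ContMDiff 𝓘(ℝ, E) (𝓘(ℝ, E).prod 𝓘(ℝ, E →L[ℝ] E →L[ℝ] ℝ)) ∞
    (fun q ↦ TotalSpace.mk' (E →L[ℝ] E →L[ℝ] ℝ)
      (E := fun q : M ↦ TangentSpace 𝓘(ℝ, E) q →L[ℝ] TangentSpace 𝓘(ℝ, E) q →L[ℝ] ℝ) q (form q))
  symm (q : M) (v w : TangentSpace 𝓘(ℝ, E) q) : form q v w = form q w v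
  lorentz (q : M) : ∃ z : TangentSpace 𝓘(ℝ, E) q, form q z z < 0 ∧
    ∀ v : TangentSpace 𝓘(ℝ, E) q, form q z v = 0 → v ≠ 0 → 0 < form q v v

/-- A metric in the preferred chart around `p`. -/
def LorentzMetric.coord (g : LorentzMetric E M) (p : M) (x : E) : E →L[ℝ] E →L[ℝ] ℝ :=
  let q := (extChartAt 𝓘(ℝ, E) p).symm x
  ((frame p q).precomp ℝ).comp ((g.form q).comp (frame p q))

/-- A field of endomorphisms in the preferred chart around `p`. -/
def coordEndo (φ : ∀ q : M, TangentSpace 𝓘(ℝ, E) q →L[ℝ] TangentSpace 𝓘(ℝ, E) q) (p : M) (x : E) :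
    E →L[ℝ] E :=
  let q := (extChartAt 𝓘(ℝ, E) p).symm x
  (coframe p q).comp ((φ q).comp (frame p q))

/-- A vector field in the preferred chart around `p`. -/
def coordVec (ξ : ∀ q : M, TangentSpace 𝓘(ℝ, E) q) (p : M) (x : E) : E :=
  let q := (extChartAt 𝓘(ℝ, E) p).symm x
  coframe p q (ξ q)

/-- A 1-form in the preferred chart around `p`. -/
def coordForm (η : ∀ q : M, TangentSpace 𝓘(ℝ, E) q →L[ℝ] ℝ) (p : M) (x : E) : E →L[ℝ] ℝ :=
  let q := (extChartAt 𝓘(ℝ, E) p).symm x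
  (η q).comp (frame p q)

/-- The curvature operator `R_p(v, w) z` of a metric, computed in the preferred chart around `p`
(it is a tensor, so any chart gives the same result). -/
def LorentzMetric.curvature (g : LorentzMetric E M) (p : M) (v w z : TangentSpace 𝓘(ℝ, E) p) :
    TangentSpace 𝓘(ℝ, E) p :=
  frame p p (coordCurvature (g.coord p) (extChartAt 𝓘(ℝ, E) p p)
    (coframe p p v) (coframe p p w) (coframe p p z))

theorem frame_coframe (p : M) (v : TangentSpace 𝓘(ℝ, E) p) : frame p p (coframe p p v) = v :=
  Trivialization.symmL_continuousLinearMapAt _ (FiberBundle.mem_baseSet_trivializationAt' p) v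

theorem coframe_frame (p : M) (v : E) : coframe p p (frame p p v) = v :=
  Trivialization.continuousLinearMapAt_symmL _ (FiberBundle.mem_baseSet_trivializationAt' p) v

namespace LorentzMetric

variable (g : LorentzMetric E M)

theorem coord_symm (p : M) (x v w : E) : g.coord p x v w = g.coord p x w v :=
  g.symm _ _ _

theorem coord_center (p : M) (v w : E) :
    g.coord p (extChartAt 𝓘(ℝ, E) p p) v w = g.form p (frame p p v) (frame p p w) := by
  have h : ∀ q, q = p → g.form q (frame p q v) (frame p q w)
      = g.form p (frame p p v) (frame p p w) := by
    rintro q rfl; rfl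
  exact h _ (extChartAt_to_inv p)

theorem nondegenerate (p : M) (v : TangentSpace 𝓘(ℝ, E) p) (hv : ∀ w, g.form p v w = 0) :
    v = 0 := by
  obtain ⟨z, -, hz⟩ := g.lorentz p
  by_contra hne
  have := hz v (by rw [g.symm]; exact hv z) hne
  rw [hv v] at this
  exact lt_irrefl _ this

theorem coord_isInvertible (p : M) : (g.coord p (extChartAt 𝓘(ℝ, E) p p)).IsInvertible := by
  set G := g.coord p (extChartAt 𝓘(ℝ, E) p p) with hG
  have hinj : Function.Injective (G : E →ₗ[ℝ] E →L[ℝ] ℝ) := by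
    rw [injective_iff_map_eq_zero]
    intro v hv
    have h0 : frame p p v = 0 := by
      refine g.nondegenerate p _ fun w ↦ ?_
      rw [← frame_coframe p w, ← g.coord_center, ← hG]
      exact congrArg (fun L : E →L[ℝ] ℝ ↦ L (coframe p p w)) hv
    rw [← coframe_frame p v, h0, map_zero]
  have hdim : Module.finrank ℝ E = Module.finrank ℝ (E →L[ℝ] ℝ) := by
    rw [← (LinearMap.toContinuousLinearMap : (E →ₗ[ℝ] ℝ) ≃ₗ[ℝ] E →L[ℝ] ℝ).finrank_eq]
    exact (Subspace.dual_finrank_eq (K := ℝ) (V := E)).symm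
  refine ⟨(LinearEquiv.ofInjectiveOfFinrankEq (G : E →ₗ[ℝ] E →L[ℝ] ℝ) hinj
    hdim).toContinuousLinearEquiv, ?_⟩
  ext v w
  rfl

theorem coord_contDiffAt (p : M) : ContDiffAt ℝ ∞ (g.coord p) (extChartAt 𝓘(ℝ, E) p p) := by
  have h1 := ((contMDiffAt_hom_bundle _).1 (g.smooth p)).2
  have h2 : ContMDiffAt 𝓘(ℝ, E) 𝓘(ℝ, E) ∞ (extChartAt 𝓘(ℝ, E) p).symm
      (extChartAt 𝓘(ℝ, E) p p) :=
    (contMDiffOn_extChartAt_symm p).contMDiffAt (extChartAt_target_mem_nhds p)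
  have h3 := ContMDiffAt.comp_of_eq h1 h2 (extChartAt_to_inv p)
  refine (contMDiffAt_iff_contDiffAt.1 h3).congr_of_eventuallyEq ?_
  filter_upwards [extChartAt_target_mem_nhds p] with x hx
  have hq : (extChartAt 𝓘(ℝ, E) p).symm x ∈ (trivializationAt E (TangentSpace 𝓘(ℝ, E)) p).baseSet := by
    have := (extChartAt 𝓘(ℝ, E) p).map_target hx
    simpa using this
  ext v w
  simp only [Function.comp_apply]
  rw [inCoordinates_apply_eq₂ hq hq (by simp), ← Trivialization.symmL_apply (R := ℝ) _ hq,
    ← Trivialization.symmL_apply (R := ℝ) _ hq]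
  simp
  rfl


variable {p : M}

theorem curvature_add (a a' b c : TangentSpace 𝓘(ℝ, E) p) :
    g.curvature p (a + a') b c = g.curvature p a b c + g.curvature p a' b c := by
  have : CompleteSpace E := FiniteDimensional.complete ℝ E
  simp only [curvature, map_add, coordCurvature_add (g.coord_symm p)
    ((g.coord_contDiffAt p).of_le (by norm_cast)) (g.coord_isInvertible p)]

theorem curvature_smul (r : ℝ) (a b c : TangentSpace 𝓘(ℝ, E) p) :
    g.curvature p (r • a) b c = r • g.curvature p a b c := by
  have : CompleteSpace E := FiniteDimensional.complete ℝ E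
  simp only [curvature, map_smul, coordCurvature_smul (g.coord_symm p)
    ((g.coord_contDiffAt p).of_le (by norm_cast)) (g.coord_isInvertible p)]

theorem curvature_self (a c : TangentSpace 𝓘(ℝ, E) p) : g.curvature p a a c = 0 := by
  simp [curvature, coordCurvature_eq]

theorem curvature_skew (a b c : TangentSpace 𝓘(ℝ, E) p) :
    g.form p (g.curvature p a b c) c = 0 := by
  have : CompleteSpace E := FiniteDimensional.complete ℝ E
  have h := coordCurvature_skew (g.coord_symm p)
    ((g.coord_contDiffAt p).of_le (by norm_cast)) (g.coord_isInvertible p)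
    (coframe p p a) (coframe p p b) (coframe p p c)
  rwa [coord_center, frame_coframe] at h

/-- The endomorphism `y ↦ R_p(y, x) x` of `T_p M`. -/
def jacobiEnd (x : TangentSpace 𝓘(ℝ, E) p) :
    TangentSpace 𝓘(ℝ, E) p →ₗ[ℝ] TangentSpace 𝓘(ℝ, E) p where
  toFun y := g.curvature p y x x
  map_add' a b := g.curvature_add a b x x
  map_smul' r a := g.curvature_smul r a x x

/-- The orthogonal complement `x^⊥` in `T_p M`. -/
def orth (x : TangentSpace 𝓘(ℝ, E) p) : Submodule ℝ (TangentSpace 𝓘(ℝ, E) p) :=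
  LinearMap.ker (g.form p x).toLinearMap

theorem jacobiEnd_mem_orth (x y : TangentSpace 𝓘(ℝ, E) p) : g.jacobiEnd x y ∈ g.orth x := by
  have h := g.curvature_skew y x x
  rwa [g.symm] at h

/-- The Jacobi operator `R_x : x^⊥ → x^⊥`, `R_x(y) = R_p(y, x) x`. -/
def jacobi (x : TangentSpace 𝓘(ℝ, E) p) : g.orth x →ₗ[ℝ] g.orth x :=
  (g.jacobiEnd x).restrict fun y _ ↦ g.jacobiEnd_mem_orth x y

/-- `span(u)` as a subspace of `u^⊥` (used for null vectors `u`). -/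
def nullLine (u : TangentSpace 𝓘(ℝ, E) p) : Submodule ℝ (g.orth u) :=
  (Submodule.span ℝ {u}).submoduleOf (g.orth u)

theorem nullLine_le (u : TangentSpace 𝓘(ℝ, E) p) :
    g.nullLine u ≤ (g.nullLine u).comap (g.jacobi u) := by
  rintro ⟨y, hy⟩ h
  obtain ⟨r, rfl⟩ := Submodule.mem_span_singleton.1 (show y ∈ Submodule.span ℝ {u} from h)
  have h0 : g.curvature p (r • u) u u = 0 := by
    rw [curvature_smul, curvature_self, smul_zero]
  change g.curvature p (r • u) u u ∈ Submodule.span ℝ {u}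
  rw [h0]
  exact zero_mem _

/-- The Jacobi operator `R̄_u` of a null vector `u`: the endomorphism of the quotient
`ū^⊥ = u^⊥ / span(u)` induced by `y ↦ R_p(y, u) u`. -/
def nullJacobi (u : TangentSpace 𝓘(ℝ, E) p) :
    (g.orth u ⧸ g.nullLine u) →ₗ[ℝ] (g.orth u ⧸ g.nullLine u) :=
  (g.nullLine u).mapQ (g.nullLine u) (g.jacobi u) (g.nullLine_le u)

/-- The null congruence set `N(z) = {u | g(u, u) = 0, g(u, z) = -1}` of a timelike unit `z`. -/
def nullCongruence (z : TangentSpace 𝓘(ℝ, E) p) : Set (TangentSpace 𝓘(ℝ, E) p) :=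
  {u | g.form p u u = 0 ∧ g.form p u z = -1}

/-- The celestial sphere `S(z) = {v ∈ z^⊥ | g(v, v) = 1}` of a timelike unit `z`. -/
def celestialSphere (z : TangentSpace 𝓘(ℝ, E) p) : Set (TangentSpace 𝓘(ℝ, E) p) :=
  {v | v ∈ g.orth z ∧ g.form p v v = 1}

end LorentzMetric

instance (p : M) : FiniteDimensional ℝ (TangentSpace 𝓘(ℝ, E) p) :=
  inferInstanceAs (FiniteDimensional ℝ E)

/-- The eigenvalues of an endomorphism of a finite-dimensional real vector space with their
(algebraic) multiplicities: the multiset of complex roots of the characteristic polynomial. -/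
def eigenvalues {V : Type*} [AddCommGroup V] [Module ℝ V] [FiniteDimensional ℝ V]
    (f : V →ₗ[ℝ] V) : Multiset ℂ :=
  (f.charpoly.map (algebraMap ℝ ℂ)).roots

/-- A globally framed `f`-structure `(φ, ξ_α, η^α)` with `s` characteristic vector fields. -/
structure FramedStructure (E : Type*) [NormedAddCommGroup E] [NormedSpace ℝ E]
    [FiniteDimensional ℝ E] (M : Type*) [TopologicalSpace M] [ChartedSpace E M]
    [IsManifold 𝓘(ℝ, E) ∞ M] (s : ℕ) where
  φ (q : M) : TangentSpace 𝓘(ℝ, E) q →L[ℝ] TangentSpace 𝓘(ℝ, E) q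
  ξ (α : Fin s) (q : M) : TangentSpace 𝓘(ℝ, E) q
  η (α : Fin s) (q : M) : TangentSpace 𝓘(ℝ, E) q →L[ℝ] ℝ
  smooth_φ : ContMDiff 𝓘(ℝ, E) (𝓘(ℝ, E).prod 𝓘(ℝ, E →L[ℝ] E)) ∞
    (fun q ↦ TotalSpace.mk' (E →L[ℝ] E)
      (E := fun q : M ↦ TangentSpace 𝓘(ℝ, E) q →L[ℝ] TangentSpace 𝓘(ℝ, E) q) q (φ q))
  smooth_ξ (α : Fin s) : ContMDiff 𝓘(ℝ, E) (𝓘(ℝ, E).prod 𝓘(ℝ, E)) ∞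
    (fun q ↦ TotalSpace.mk' E (E := fun q : M ↦ TangentSpace 𝓘(ℝ, E) q) q (ξ α q))
  smooth_η (α : Fin s) : ContMDiff 𝓘(ℝ, E) (𝓘(ℝ, E).prod 𝓘(ℝ, E →L[ℝ] ℝ)) ∞
    (fun q ↦ TotalSpace.mk' (E →L[ℝ] ℝ)
      (E := fun q : M ↦ TangentSpace 𝓘(ℝ, E) q →L[ℝ] ℝ) q (η α q))
  φ_ne_zero (q : M) : φ q ≠ 0
  φ_φ (q : M) (v : TangentSpace 𝓘(ℝ, E) q) : φ q (φ q v) = -v + ∑ α, η α q v • ξ α q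
  η_ξ (α β : Fin s) (q : M) : η α q (ξ β q) = if α = β then 1 else 0

/-- `(M, φ, ξ_α, η^α, g)` is a Lorentzian `S`-manifold whose timelike characteristic vector field
is the first one. The characteristic vector fields are numbered from `0`, so `S.ξ 0` is `ξ_1`. -/
structure IsLorentzSManifold {s : ℕ} [NeZero s] (g : LorentzMetric E M)
    (S : FramedStructure E M s) : Prop where
  /-- The characteristic vector fields are unit vector fields. -/
  unit (α : Fin s) (q : M) : g.form q (S.ξ α q) (S.ξ α q) = 1 ∨ g.form q (S.ξ α q) (S.ξ α q) = -1
  /-- The metric is compatible with the structure; here `g(ξ_α, ξ_α) = ε_α`. -/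
  compatible (q : M) (v w : TangentSpace 𝓘(ℝ, E) q) :
    g.form q (S.φ q v) (S.φ q w) =
      g.form q v w - ∑ α, g.form q (S.ξ α q) (S.ξ α q) * S.η α q v * S.η α q w
  /-- `ξ_1` is the timelike characteristic vector field. -/
  timelike (q : M) : g.form q (S.ξ 0 q) (S.ξ 0 q) = -1
  /-- `Φ = dη^α` for every `α`, where `Φ(X, Y) = g(X, φY)`; stated in each preferred chart. -/
  contact (p : M) (x : E) (_ : x ∈ (extChartAt 𝓘(ℝ, E) p).target) (α : Fin s) (v w : E) :
    g.coord p x v (coordEndo S.φ p x w) = coordExtDeriv (coordForm (S.η α) p) x v w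
  /-- Normality: `[φ, φ] + 2 dη^α ⊗ ξ_α = 0`; stated in each preferred chart. -/
  normal (p : M) (x : E) (_ : x ∈ (extChartAt 𝓘(ℝ, E) p).target) (v w : E) :
    coordNijenhuis (coordEndo S.φ p) x v w
      + ∑ α, (2 * coordExtDeriv (coordForm (S.η α) p) x v w) • coordVec (S.ξ α) p x = 0

section Osserman

variable {s : ℕ} [NeZero s] (g : LorentzMetric E M) (S : FramedStructure E M s) (p : M)

/-- The `φ`-celestial sphere `S_φ((ξ_1)_p) = S((ξ_1)_p) ∩ Im(φ_p)`. -/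
def phiCelestialSphere : Set (TangentSpace 𝓘(ℝ, E) p) :=
  {x | x ∈ g.celestialSphere (S.ξ 0 p) ∧ ∃ y, S.φ p y = x}

/-- The `φ`-null congruence set `N_φ((ξ_1)_p) = ψ⁻¹(S_φ((ξ_1)_p))`, where
`ψ : N((ξ_1)_p) → S((ξ_1)_p)` is `ψ(u) = u - (ξ_1)_p`. -/
def phiNullCongruence : Set (TangentSpace 𝓘(ℝ, E) p) :=
  {u | u ∈ g.nullCongruence (S.ξ 0 p) ∧ u - S.ξ 0 p ∈ phiCelestialSphere g S p}

/-- `M` is `φ`-null Osserman with respect to `(ξ_1)_p`: the eigenvalues of `R̄_u` with their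
multiplicities do not depend on `u ∈ N_φ((ξ_1)_p)`. -/
def IsPhiNullOsserman : Prop :=
  ∀ u ∈ phiNullCongruence g S p, ∀ v ∈ phiNullCongruence g S p,
    eigenvalues (g.nullJacobi u) = eigenvalues (g.nullJacobi v)

end Osserman

end Manifold

end

end LorentzS

/-!
The proof computes both families of Jacobi operators on a common subspace.

*Curvature on the characteristic fields.* At each point normality, `Φ = dη^α` and the closedness of
`Φ` determine the first covariant derivatives of the structure: the `ξ_α` are commuting Killing
fields with `∇_v ξ_α = -ε_α φ v` (`IsSJet.B_eq`), and `∇φ` is given by `IsSJet.metric_A`. These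
arguments are linear algebra in the values of `∇φ` and `∇ξ_α` at one point, and
`IsLocalS.isSJet` obtains the identities they start from by differentiating the structure equations
in a chart. Differentiating `∇_v ξ_α = -ε_α φ v` once more gives
`R(a, b) ξ_α = ε_α (η̃(a) φ² b - η̃(b) φ² a)` with `η̃ = ∑ ε_β η^β`
(`IsLorentzSManifold.curvature_ξ`).

*Comparison of the operators.* Let `x` be in the `φ`-celestial sphere, let `u = ξ_1 + x`, and let `D`
be the orthogonal complement of `x` in `Im φ_p`. Every element of the `φ`-null congruence set is such
a `u`. The formula above and the pair symmetry of `R` show that `R_x` preserves both summands of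
`x^⊥ = span(ξ_1, …, ξ_s) ⊕ D` and acts on the first one by a matrix independent of `x`. Likewise
`u^⊥ / span(u)` is isomorphic to `span(ξ_2, …, ξ_s) ⊕ D`, and `R̄_u` is there the sum of a matrix
independent of `x` and of `R_x|_D + 1`. Hence (`charpoly_jacobi`, `charpoly_nullJacobi`) both
characteristic polynomials are fixed multiples of those of `R_x|_D` and `R_x|_D + 1`, and each of the
latter two determines the other.
-/

namespace LorentzS

noncomputable section

/-! ### The linear algebra of a metric framed structure at a point -/

section Pointwise

/-- A metric framed structure on a single vector space: a nondegenerate symmetric form `G`, a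
`G`-skew endomorphism `F` with `F² = -1 + ∑ η^α ⊗ ξ_α` and kernel spanned by the `G`-orthonormal
vectors `ξ_α`, which are `G`-dual to the `η^α` up to the signs `ε_α = G(ξ_α, ξ_α)`. -/
structure IsMetricFrame {V ι : Type*} [AddCommGroup V] [Module ℝ V] [TopologicalSpace V]
    [IsTopologicalAddGroup V] [ContinuousConstSMul ℝ V] [Fintype ι] [DecidableEq ι]
    (G : V →L[ℝ] V →L[ℝ] ℝ) (F : V →L[ℝ] V) (ξ : ι → V) (η : ι → V →L[ℝ] ℝ) (ε : ι → ℝ) :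
    Prop where
  symm (v w : V) : G v w = G w v
  nondeg (v : V) : (∀ w, G v w = 0) → v = 0
  sq (v : V) : F (F v) = -v + ∑ α, η α v • ξ α
  dual (α β : ι) : η α (ξ β) = if α = β then 1 else 0
  metric_ξ (α : ι) (v : V) : G (ξ α) v = ε α * η α v
  skew (v w : V) : G (F v) w = -G v (F w)
  F_ξ (α : ι) : F (ξ α) = 0
  ε_sq (α : ι) : ε α * ε α = 1

namespace IsMetricFrame

variable {V ι : Type*} [AddCommGroup V] [Module ℝ V] [TopologicalSpace V]
    [IsTopologicalAddGroup V] [ContinuousConstSMul ℝ V] [Fintype ι] [DecidableEq ι]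
    {G : V →L[ℝ] V →L[ℝ] ℝ} {F : V →L[ℝ] V} {ξ : ι → V} {η : ι → V →L[ℝ] ℝ} {ε : ι → ℝ}

theorem η_eq (h : IsMetricFrame G F ξ η ε) (α : ι) (v : V) : η α v = ε α * G (ξ α) v := by
  rw [h.metric_ξ, ← mul_assoc, h.ε_sq, one_mul]

theorem metric_ξ_F (h : IsMetricFrame G F ξ η ε) (α : ι) (v : V) : G (ξ α) (F v) = 0 := by
  have := h.skew (ξ α) v
  rw [h.F_ξ] at this
  simpa using this

theorem metric_F_ξ (h : IsMetricFrame G F ξ η ε) (α : ι) (v : V) : G (F v) (ξ α) = 0 := by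
  rw [h.symm, h.metric_ξ_F]

theorem η_F (h : IsMetricFrame G F ξ η ε) (α : ι) (v : V) : η α (F v) = 0 := by
  rw [h.η_eq, h.metric_ξ_F, mul_zero]

theorem ext_metric (h : IsMetricFrame G F ξ η ε) {v w : V} (hvw : ∀ z, G v z = G w z) :
    v = w :=
  sub_eq_zero.1 (h.nondeg _ fun z ↦ by simp [hvw z])

/-- The splitting of the space into the span of the `ξ_α` and the image of `F`. -/
theorem decomp (h : IsMetricFrame G F ξ η ε) (v : V) :
    v = F (F (-v)) + ∑ α, η α v • ξ α := by
  rw [map_neg, map_neg, h.sq]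
  abel

theorem eq_zero (h : IsMetricFrame G F ξ η ε) {v : V} (hF : F v = 0)
    (hη : ∀ α, G v (ξ α) = 0) : v = 0 := by
  rw [h.decomp v]
  simp [hF, h.η_eq, h.symm _ v, hη]

end IsMetricFrame

/-- The first order identities of an `S`-structure at a point. Here `A v w` and `B α v` stand for
the covariant derivatives `(∇_v φ) w` and `∇_v ξ_α`; the fields are `Φ = dη^α`, the skewness of
`∇_v φ`, the closedness of `Φ`, the derivative of `φ ξ_α = 0`, normality, and the derivative of
`g(ξ_α, ξ_β) = const`. -/
structure IsSJet {V ι : Type*} [NormedAddCommGroup V] [NormedSpace ℝ V]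
    [Fintype ι] [DecidableEq ι]
    (G : V →L[ℝ] V →L[ℝ] ℝ) (F : V →L[ℝ] V) (ξ : ι → V) (η : ι → V →L[ℝ] ℝ) (ε : ι → ℝ)
    (A : V →L[ℝ] V →L[ℝ] V) (B : ι → V →L[ℝ] V) : Prop extends IsMetricFrame G F ξ η ε where
  contact (α : ι) (v w : V) : 2 * G v (F w) = ε α * (G (B α v) w - G (B α w) v)
  A_skew (a b c : V) : G (A a b) c = -G (A a c) b
  A_cyc (a b c : V) : G (A a b) c + G (A b c) a + G (A c a) b = 0
  A_ξ (α : ι) (v : V) : A v (ξ α) = -F (B α v)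
  normal (v w : V) :
    A (F v) w - A (F w) v - F (A v w) + F (A w v) + ∑ α, (2 * G v (F w)) • ξ α = 0
  B_orth (α β : ι) (v : V) : G (B α v) (ξ β) + G (ξ α) (B β v) = 0

namespace IsSJet

variable {V ι : Type*} [NormedAddCommGroup V] [NormedSpace ℝ V]
    [Fintype ι] [DecidableEq ι]
    {G : V →L[ℝ] V →L[ℝ] ℝ} {F : V →L[ℝ] V} {ξ : ι → V} {η : ι → V →L[ℝ] ℝ} {ε : ι → ℝ}
    {A : V →L[ℝ] V →L[ℝ] V} {B : ι → V →L[ℝ] V}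

theorem contact_ε (h : IsSJet G F ξ η ε A B) (α : ι) (v w : V) :
    G (B α v) w - G (B α w) v = ε α * (2 * G v (F w)) := by
  rw [h.contact α, ← mul_assoc, h.ε_sq, one_mul]

/-- `∇_{ξ_β} ξ_α` against any vector: `ξ_β` lies in the kernel of `dη^α`. -/
theorem metric_B_ξ_left (h : IsSJet G F ξ η ε A B) (α β : ι) (v : V) :
    G (B α (ξ β)) v = G (B α v) (ξ β) := by
  have := h.contact_ε α v (ξ β)
  rw [h.F_ξ] at this
  simp at this
  linarith

/-- The Lie derivative of `φ` along `ξ_α` vanishes. -/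
theorem A_ξ_left (h : IsSJet G F ξ η ε A B) (α : ι) (w : V) :
    A (ξ α) w = B α (F w) - F (B α w) := by
  have hF : F (A (ξ α) w - (B α (F w) - F (B α w))) = 0 := by
    have h1 := h.normal (ξ α) w
    rw [h.F_ξ, h.metric_ξ_F, h.A_ξ, h.A_ξ] at h1
    simp only [map_zero, zero_apply, mul_zero, zero_smul, Finset.sum_const_zero, add_zero,
      map_neg] at h1
    simp only [map_sub]
    rw [← neg_eq_zero, ← h1]
    abel
  refine sub_eq_zero.1 (h.eq_zero hF fun β ↦ ?_)
  have h1 : G (A (ξ α) w) (ξ β) = -G (B β (ξ α)) (F w) := by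
    rw [h.A_skew, h.A_ξ]
    simp [h.skew]
  have h2 := h.B_orth α β (F w)
  have h3 := h.metric_B_ξ_left β α (F w)
  simp only [map_sub, sub_apply, h.metric_F_ξ, h1, sub_zero]
  rw [h.symm (ξ α)] at h2
  linarith

/-- The fields `ξ_α` commute: `∇_{ξ_α} ξ_β = ∇_{ξ_β} ξ_α`. -/
theorem B_ξ_comm (h : IsSJet G F ξ η ε A B) (α β : ι) : B β (ξ α) = B α (ξ β) := by
  refine sub_eq_zero.1 (h.eq_zero ?_ fun γ ↦ ?_)
  · have h1 := h.A_ξ_left α (ξ β)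
    rw [h.A_ξ, h.F_ξ, map_zero, zero_sub, neg_inj] at h1
    rw [map_sub, h1, sub_self]
  · have h1 := h.B_orth β γ (ξ α)
    have h2 := h.B_orth α γ (ξ β)
    have h3 := h.metric_B_ξ_left γ α (ξ β)
    rw [h.symm (ξ _)] at h1 h2
    simp only [map_sub, sub_apply]
    linarith

theorem metric_B_ξ (h : IsSJet G F ξ η ε A B) (α β : ι) (v : V) : G (B α v) (ξ β) = 0 := by
  have h1 := h.B_orth α β v
  have h2 := h.metric_B_ξ_left α β v
  have h3 := h.metric_B_ξ_left β α v
  rw [h.B_ξ_comm] at h3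
  rw [h.symm (ξ _)] at h1
  linarith

/-- Each `ξ_α` is a Killing field: its Lie derivative kills `φ` and `Φ`, hence the metric on the
image of `φ`, and the remaining components vanish as well. -/
theorem killing (h : IsSJet G F ξ η ε A B) (α : ι) (v w : V) :
    G (B α v) w + G (B α w) v = 0 := by
  have key : ∀ b c, G (B α (F b)) c + G (B α c) (F b) = 0 := by
    intro b c
    have h1 := h.A_cyc (ξ α) b c
    rw [h.A_skew b, h.A_ξ, h.A_ξ, h.A_ξ_left] at h1
    simp only [map_sub, map_neg, sub_apply, neg_apply, h.skew] at h1
    linarith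
  rw [h.decomp v]
  have hξ : ∀ β, G (B α (ξ β)) w + G (B α w) (ξ β) = 0 := by
    intro β
    rw [h.metric_B_ξ_left, h.metric_B_ξ, add_zero]
  have hsum : ∑ β, η β v * (G (B α (ξ β)) w + G (B α w) (ξ β)) = 0 :=
    Finset.sum_eq_zero fun β _ ↦ by rw [hξ, mul_zero]
  have hk := key (F (-v)) w
  simp only [map_add, map_sum, map_smul, add_apply, _root_.sum_apply, smul_apply,
    smul_eq_mul, mul_add, Finset.sum_add_distrib] at hsum ⊢
  linarith

/-- `∇_v ξ_α = -ε_α φ v`. -/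
theorem B_eq (h : IsSJet G F ξ η ε A B) (α : ι) (v : V) : B α v = -(ε α • F v) := by
  refine h.ext_metric fun z ↦ ?_
  have h1 := h.contact_ε α v z
  have h2 := h.killing α v z
  have h3 := h.skew v z
  simp only [map_neg, map_smul, neg_apply, smul_apply, smul_eq_mul, h3]
  linarith

theorem A_ξ_eq (h : IsSJet G F ξ η ε A B) (α : ι) (v : V) : A v (ξ α) = ε α • F (F v) := by
  rw [h.A_ξ, h.B_eq]; simp

/-- On the image of `φ` the covariant derivative of `φ` has no component in the image of `φ`.
Normality and closedness of `Φ` express `T(φx, y, z) + T(φy, z, x) = T(φz, x, y)` for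
`T(x, y, z) = g((∇_x φ) y, z)` and `x`, `y`, `z` in the image of `φ`; adding a cyclic permutation of
this identity gives `T(φy, z, x) = 0`. -/
theorem metric_A_F (h : IsSJet G F ξ η ε A B) (x y z : V) :
    G (A (F (F x)) (F y)) (F z) = 0 := by
  have key : ∀ x y z, G (A (F (F x)) (F y)) (F z) + G (A (F (F y)) (F z)) (F x)
      = G (A (F (F z)) (F x)) (F y) := by
    intro x y z
    have h1 := congrArg (fun v ↦ G v (F z)) (h.normal (F x) (F y))
    simp only [map_add, map_sub, map_sum, map_smul, add_apply, sub_apply, _root_.sum_apply,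
      smul_apply, h.metric_ξ_F, smul_zero, Finset.sum_const_zero, map_zero, zero_apply,
      h.skew] at h1
    have h2 := h.A_cyc (F x) (F y) (F (F z))
    have h3 := h.A_skew (F y) (F x) (F (F z))
    have h4 := h.A_skew (F (F y)) (F x) (F z)
    linarith
  have h1 := key x y z
  have h2 := key z x y
  have h3 := key y z x
  linarith

/-- The covariant derivative of `φ` on an `S`-manifold, paired with a vector:
`g((∇_z φ) a, b) = η̃(a) g(φ² z, b) - η̃(b) g(φ² z, a)` with `η̃ = ∑ ε_α η^α`. -/
theorem metric_A (h : IsSJet G F ξ η ε A B) (z a b : V) :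
    G (A z a) b =
      (∑ α, ε α * η α a) * G (F (F z)) b - (∑ α, ε α * η α b) * G (F (F z)) a := by
  have hξ1 : ∀ α z b, G (A z (ξ α)) b = ε α * G (F (F z)) b := by
    intro α z b; rw [h.A_ξ_eq]; simp
  have hξ2 : ∀ α z a, G (A z a) (ξ α) = -(ε α * G (F (F z)) a) := by
    intro α z a; rw [h.A_skew, hξ1]
  have hξF : ∀ α v w, G (A (ξ α) (F v)) (F w) = 0 := by
    intro α v w
    have h1 := h.A_cyc (ξ α) (F v) (F w)
    rw [hξ1, hξ2] at h1
    rw [h.skew (F (F w)), h.skew (F (F v)), h.symm (F (F w))] at h1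
    linarith
  have hF : ∀ v w, G (A z (F v)) (F w) = 0 := by
    intro v w
    rw [h.decomp z]
    simp [h.metric_A_F, hξF]
  have hF2 : ∀ v w, G (A z (F v)) w = -(∑ α, ε α * η α w) * G (F (F z)) (F v) := by
    intro v w
    conv_lhs => rw [h.decomp w]
    simp only [map_add, map_sum, map_smul, hF, hξ2, smul_eq_mul, zero_add, Finset.sum_mul,
      neg_mul, ← Finset.sum_neg_distrib]
    exact Finset.sum_congr rfl fun α _ ↦ by ring
  have hFa : G (F (F z)) (F (F (-a))) = G (F (F z)) a := by
    conv_rhs => rw [h.decomp a]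
    simp [h.metric_F_ξ]
  conv_lhs => rw [h.decomp a]
  simp only [map_add, map_sum, map_smul, add_apply, _root_.sum_apply, smul_apply, hF2, hFa, hξ1,
    smul_eq_mul, Finset.sum_mul]
  rw [add_comm, neg_mul, ← sub_eq_add_neg, Finset.sum_mul]
  congr 1
  exact Finset.sum_congr rfl fun α _ ↦ by ring

/-- The skew part of `∇φ`. -/
theorem A_sub_A (h : IsSJet G F ξ η ε A B) (a b : V) :
    A a b - A b a =
      (∑ α, ε α * η α b) • F (F a) - (∑ α, ε α * η α a) • F (F b) := by
  refine h.ext_metric fun z ↦ ?_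
  have h1 := h.metric_A a b z
  have h2 := h.metric_A b a z
  have h3 : G (F (F a)) b = G (F (F b)) a := by
    rw [h.skew, h.skew, neg_neg, h.symm]
  simp only [map_sub, map_smul, sub_apply, smul_apply, smul_eq_mul, h1, h2, h3]
  ring

end IsSJet

end Pointwise

/-! ### Covariant derivatives in coordinates -/

section CoordinateJets

set_option maxSynthPendingDepth 3

variable {E : Type*} [NormedAddCommGroup E] [NormedSpace ℝ E]

theorem fderiv_apply_const {W : Type*} [NormedAddCommGroup W] [NormedSpace ℝ W]
    {L : E → E →L[ℝ] W} {x : E} (hd : DifferentiableAt ℝ L x) (v a : E) :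
    fderiv ℝ (fun y ↦ L y v) x a = fderiv ℝ L x a v := by
  rw [(hd.hasFDerivAt.clm_apply (hasFDerivAt_const v x)).fderiv]; simp

/-- The combination of permutations of the arguments of a trilinear form that turns the derivative
of a metric into twice its Christoffel symbols of the first kind. -/
def koszulPerm (E : Type*) [NormedAddCommGroup E] [NormedSpace ℝ E] :
    (E →L[ℝ] E →L[ℝ] E →L[ℝ] ℝ) →L[ℝ] (E →L[ℝ] E →L[ℝ] E →L[ℝ] ℝ) :=
  let σ : (E →L[ℝ] E →L[ℝ] E →L[ℝ] ℝ) →L[ℝ] (E →L[ℝ] E →L[ℝ] E →L[ℝ] ℝ) :=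
    (ContinuousLinearMap.flipₗᵢ ℝ E E (E →L[ℝ] ℝ)).toContinuousLinearEquiv
  let τ : (E →L[ℝ] E →L[ℝ] E →L[ℝ] ℝ) →L[ℝ] (E →L[ℝ] E →L[ℝ] E →L[ℝ] ℝ) :=
    ContinuousLinearMap.compL ℝ E (E →L[ℝ] E →L[ℝ] ℝ) (E →L[ℝ] E →L[ℝ] ℝ)
      (ContinuousLinearMap.flipₗᵢ ℝ E E ℝ).toContinuousLinearEquiv
  ContinuousLinearMap.id ℝ _ + σ - τ.comp σ

theorem koszulPerm_apply (T : E →L[ℝ] E →L[ℝ] E →L[ℝ] ℝ) (v w z : E) :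
    koszulPerm E T v w z = T v w z + T w v z - T z v w := rfl

/-- The Christoffel symbols of `G` at a point as a continuous bilinear map. -/
def christoffelL (G : E → E →L[ℝ] E →L[ℝ] ℝ) (x : E) : E →L[ℝ] E →L[ℝ] E :=
  (ContinuousLinearMap.compL ℝ E (E →L[ℝ] ℝ) E ((1 / 2 : ℝ) • (G x).inverse)).comp
    (koszulPerm E (fderiv ℝ G x))

variable {G : E → E →L[ℝ] E →L[ℝ] ℝ} {x : E}

theorem christoffelL_apply (hd : DifferentiableAt ℝ G x) (v w : E) :
    christoffelL G x v w = christoffel G x v w := by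
  have : koszul G x v w = koszulPerm E (fderiv ℝ G x) v w := by
    ext z; rw [koszul_apply hd, koszulPerm_apply]
  rw [christoffel, this, map_smul]
  rfl

theorem differentiableAt_christoffelL [CompleteSpace E] (hd : ContDiffAt ℝ 2 G x)
    (hi : (G x).IsInvertible) : DifferentiableAt ℝ (christoffelL G) x := by
  have hinv0 : DifferentiableAt ℝ (fun y ↦ (G y).inverse) x :=
    ((hi.contDiffAt_map_inverse (n := 1)).differentiableAt (by simp)).comp x
      (hd.differentiableAt (by simp))
  have hinv : DifferentiableAt ℝ (fun y ↦ (1 / 2 : ℝ) • (G y).inverse) x :=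
    hinv0.const_smul (1 / 2 : ℝ)
  have h1 : DifferentiableAt ℝ (fun y ↦ koszulPerm E (fderiv ℝ G y)) x :=
    (koszulPerm E).differentiableAt.comp x
      ((hd.fderiv_right (m := 1) (by norm_num)).differentiableAt (by simp))
  exact ((ContinuousLinearMap.compL ℝ E (E →L[ℝ] ℝ) E).differentiableAt.comp x hinv).clm_comp h1

/-- The curvature through the bundled Christoffel symbols, which exhibits its trilinearity. -/
theorem coordCurvature_eq_christoffelL [CompleteSpace E] (hd : ContDiffAt ℝ 2 G x)
    (hi : (G x).IsInvertible) (a b c : E) :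
    coordCurvature G x a b c =
      fderiv ℝ (christoffelL G) x a b c + christoffelL G x a (christoffelL G x b c)
        - (fderiv ℝ (christoffelL G) x b a c
          + christoffelL G x b (christoffelL G x a c)) := by
  have hΓ := differentiableAt_christoffelL hd hi
  have hC : ∀ b c, (fun y ↦ christoffel G y b c) =ᶠ[𝓝 x] fun y ↦ christoffelL G y b c := by
    intro b c
    filter_upwards [eventually_differentiableAt hd] with y hy
    rw [christoffelL_apply hy]
  have hD : ∀ a b c, fderiv ℝ (fun y ↦ christoffel G y b c) x a =
      fderiv ℝ (christoffelL G) x a b c := by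
    intro a b c
    rw [(hC b c).fderiv_eq, ((hΓ.hasFDerivAt.clm_apply (hasFDerivAt_const b x)).clm_apply
      (hasFDerivAt_const c x)).fderiv]
    simp
  rw [coordCurvature_eq]
  simp only [hD, ← christoffelL_apply (hd.differentiableAt (by simp))]

/-- The first Bianchi identity. -/
theorem coordCurvature_cyc [CompleteSpace E] (hs : ∀ y v w, G y v w = G y w v)
    (hd : ContDiffAt ℝ 2 G x) (hi : (G x).IsInvertible) (a b c : E) :
    coordCurvature G x a b c + coordCurvature G x b c a + coordCurvature G x c a b = 0 := by
  have hΓ := (differentiableAt_christoffelL hd hi).hasFDerivAt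
  have hsymm : ∀ v w, christoffelL G x v w = christoffelL G x w v := by
    intro v w
    have := hd.differentiableAt (n := 2) (by simp)
    rw [christoffelL_apply this, christoffelL_apply this, christoffel_symm hs]
  have hD : ∀ a b c, fderiv ℝ (christoffelL G) x a b c = fderiv ℝ (christoffelL G) x a c b := by
    intro a b c
    have h1 : (fun y ↦ christoffelL G y b c) =ᶠ[𝓝 x] fun y ↦ christoffelL G y c b := by
      filter_upwards [eventually_differentiableAt hd] with y hy
      rw [christoffelL_apply hy, christoffelL_apply hy, christoffel_symm hs]
    have h2 : ∀ b c, HasFDerivAt (fun y ↦ christoffelL G y b c) _ x := fun b c ↦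
      (hΓ.clm_apply (hasFDerivAt_const b x)).clm_apply (hasFDerivAt_const c x)
    have h3 := congrArg (fun L ↦ L a) (h1.fderiv_eq (𝕜 := ℝ))
    rw [(h2 b c).fderiv, (h2 c b).fderiv] at h3
    simpa using h3
  simp only [coordCurvature_eq_christoffelL hd hi]
  rw [hD a c b, hD b a c, hD c b a, hsymm c b, hsymm c a, hsymm b a]
  abel

/-- The covariant derivative `(v, w) ↦ (∇_v φ) w` of a field of endomorphisms in coordinates. -/
def covEndo (G : E → E →L[ℝ] E →L[ℝ] ℝ) (F : E → E →L[ℝ] E) (x : E) : E →L[ℝ] E →L[ℝ] E :=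
  fderiv ℝ F x
    + ((ContinuousLinearMap.compL ℝ E E E).flip (F x)).comp (christoffelL G x)
    - (ContinuousLinearMap.compL ℝ E E E (F x)).comp (christoffelL G x)

theorem covEndo_apply (F : E → E →L[ℝ] E) (v w : E) :
    covEndo G F x v w =
      fderiv ℝ F x v w + christoffelL G x v (F x w) - F x (christoffelL G x v w) := rfl

/-- The covariant derivative `v ↦ ∇_v ξ` of a vector field in coordinates. -/
def covVec (G : E → E →L[ℝ] E →L[ℝ] ℝ) (ξ : E → E) (x : E) : E →L[ℝ] E :=
  fderiv ℝ ξ x + (christoffelL G x).flip (ξ x)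

theorem covVec_apply (ξ : E → E) (v : E) :
    covVec G ξ x v = fderiv ℝ ξ x v + christoffelL G x v (ξ x) := rfl

/-- The coordinate expression near `x` of a Lorentzian `S`-structure: fields of class `C²` that
form a metric framed structure at every point near `x` and satisfy there the contact condition
`Φ = dη^α` and normality. -/
structure IsLocalS {ι : Type*} [Fintype ι] [DecidableEq ι] (G : E → E →L[ℝ] E →L[ℝ] ℝ)
    (F : E → E →L[ℝ] E) (ξ : ι → E → E) (η : ι → E → E →L[ℝ] ℝ) (ε : ι → ℝ) (x : E) : Prop where
  contDiff_G : ContDiffAt ℝ 2 G x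
  contDiff_F : ContDiffAt ℝ 2 F x
  contDiff_ξ (α : ι) : ContDiffAt ℝ 2 (ξ α) x
  contDiff_η (α : ι) : ContDiffAt ℝ 2 (η α) x
  symm (y v w : E) : G y v w = G y w v
  invertible : (G x).IsInvertible
  frame : ∀ᶠ y in 𝓝 x, IsMetricFrame (G y) (F y) (fun α ↦ ξ α y) (fun α ↦ η α y) ε
  contact : ∀ᶠ y in 𝓝 x, ∀ α v w, G y v (F y w) = coordExtDeriv (η α) y v w
  normal : ∀ᶠ y in 𝓝 x, ∀ v w, coordNijenhuis F y v w
      + ∑ α, (2 * coordExtDeriv (η α) y v w) • ξ α y = 0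

namespace IsLocalS

variable {ι : Type*} [Fintype ι] [DecidableEq ι] {F : E → E →L[ℝ] E}
  {ξ : ι → E → E} {η : ι → E → E →L[ℝ] ℝ} {ε : ι → ℝ}

theorem eventually [CompleteSpace E] (h : IsLocalS G F ξ η ε x) :
    ∀ᶠ y in 𝓝 x, IsLocalS G F ξ η ε y := by
  have hξ : ∀ᶠ y in 𝓝 x, ∀ α, ContDiffAt ℝ 2 (ξ α) y :=
    Filter.eventually_all.2 fun α ↦ (h.contDiff_ξ α).eventually (by simp)
  have hη : ∀ᶠ y in 𝓝 x, ∀ α, ContDiffAt ℝ 2 (η α) y :=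
    Filter.eventually_all.2 fun α ↦ (h.contDiff_η α).eventually (by simp)
  filter_upwards [h.contDiff_G.eventually (by simp), h.contDiff_F.eventually (by simp), hξ, hη,
    eventually_isInvertible h.contDiff_G.continuousAt h.invertible,
    h.frame.eventually_nhds, h.contact.eventually_nhds, h.normal.eventually_nhds]
    with y h1 h2 h3 h4 h5 h6 h7 h8
  exact ⟨h1, h2, h3, h4, h.symm, h5, h6, h7, h8⟩

theorem differentiable_G (h : IsLocalS G F ξ η ε x) : DifferentiableAt ℝ G x :=
  h.contDiff_G.differentiableAt (by simp)

theorem differentiable_F (h : IsLocalS G F ξ η ε x) : DifferentiableAt ℝ F x :=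
  h.contDiff_F.differentiableAt (by simp)

theorem differentiable_ξ (h : IsLocalS G F ξ η ε x) (α : ι) : DifferentiableAt ℝ (ξ α) x :=
  (h.contDiff_ξ α).differentiableAt (by simp)

theorem differentiable_η (h : IsLocalS G F ξ η ε x) (α : ι) : DifferentiableAt ℝ (η α) x :=
  (h.contDiff_η α).differentiableAt (by simp)

theorem christoffelL_symm (h : IsLocalS G F ξ η ε x) (v w : E) :
    christoffelL G x v w = christoffelL G x w v := by
  rw [christoffelL_apply h.differentiable_G, christoffelL_apply h.differentiable_G,
    christoffel_symm h.symm]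

theorem fderiv_G (h : IsLocalS G F ξ η ε x) (a b c : E) :
    fderiv ℝ G x a b c
      = G x (christoffelL G x a b) c + G x b (christoffelL G x a c) := by
  have h0 := h.differentiable_G
  rw [← fderiv_apply₂ h0, fderiv_eq_christoffel h.symm h0 h.invertible, christoffelL_apply h0,
    christoffelL_apply h0]

theorem coordExtDeriv_eq (h : IsLocalS G F ξ η ε x) (α : ι) (v w : E) :
    coordExtDeriv (η α) x v w =
      (1 / 2 : ℝ) * (fderiv ℝ (η α) x v w - fderiv ℝ (η α) x w v) := by
  have h0 := h.differentiable_η α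
  simp [coordExtDeriv, fderiv_apply_const h0, lieBracket_const]

theorem fderiv_η (h : IsLocalS G F ξ η ε x) (α : ι) (v w : E) :
    fderiv ℝ (η α) x v w =
      ε α * G x (covVec G (ξ α) x v) w + η α x (christoffelL G x v w) := by
  have h1 : (fun y ↦ η α y w) =ᶠ[𝓝 x] fun y ↦ ε α * G y (ξ α y) w := by
    filter_upwards [h.frame] with y hy using hy.η_eq α w
  have h2 := ((h.differentiable_G.hasFDerivAt.clm_apply
    (h.differentiable_ξ α).hasFDerivAt).clm_apply (hasFDerivAt_const w x)).const_mul (ε α)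
  have h3 := congrArg (fun L ↦ L v) (h1.fderiv_eq (𝕜 := ℝ))
  have h4 := h.fderiv_G v (ξ α x) w
  rw [h2.fderiv, fderiv_apply_const (h.differentiable_η α)] at h3
  simp only [add_apply, smul_apply, ContinuousLinearMap.comp_apply,
    ContinuousLinearMap.flip_apply, zero_apply, map_zero, zero_add, smul_eq_mul, h4] at h3
  rw [h3, h.frame.self_of_nhds.η_eq, covVec_apply, map_add, add_apply]
  ring

theorem covEndo_skew (h : IsLocalS G F ξ η ε x) (a b c : E) :
    G x (covEndo G F x a b) c = -G x (covEndo G F x a c) b := by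
  have h0 := h.frame.self_of_nhds
  have h1 : (fun y ↦ G y (F y b) c) =ᶠ[𝓝 x] fun y ↦ -G y (F y c) b := by
    filter_upwards [h.frame] with y hy
    rw [hy.skew, hy.symm]
  have h2 : ∀ b c, HasFDerivAt (fun y ↦ G y (F y b) c) _ x := fun b c ↦
    (h.differentiable_G.hasFDerivAt.clm_apply
      (h.differentiable_F.hasFDerivAt.clm_apply (hasFDerivAt_const b x))).clm_apply
      (hasFDerivAt_const c x)
  have h3 := congrArg (fun L ↦ L a) (h1.fderiv_eq (𝕜 := ℝ))
  rw [(h2 b c).fderiv, (h2 c b).fun_neg.fderiv] at h3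
  simp only [add_apply, ContinuousLinearMap.comp_apply,
    ContinuousLinearMap.flip_apply, zero_apply, map_zero, zero_add, neg_apply, h.fderiv_G] at h3
  simp only [covEndo_apply, map_add, map_sub, add_apply, sub_apply, h0.skew]
  rw [h0.symm (F x b), h0.symm (F x c)] at h3
  linarith

theorem covEndo_cyc (h : IsLocalS G F ξ η ε x) [Nonempty ι] (a b c : E) :
    G x (covEndo G F x a b) c + G x (covEndo G F x b c) a + G x (covEndo G F x c a) b = 0 := by
  have h0 := h.frame.self_of_nhds
  obtain ⟨α⟩ := ‹Nonempty ι›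
  have hη' : DifferentiableAt ℝ (fderiv ℝ (η α)) x :=
    ((h.contDiff_η α).fderiv_right (m := 1) (by norm_num)).differentiableAt (by simp)
  have hη : ∀ᶠ y in 𝓝 x, DifferentiableAt ℝ (η α) y := by
    filter_upwards [(h.contDiff_η α).eventually (by simp)] with y hy
      using hy.differentiableAt (by simp)
  have hsymm : ∀ a b, fderiv ℝ (fderiv ℝ (η α)) x a b = fderiv ℝ (fderiv ℝ (η α)) x b a :=
    fun a b ↦ ((h.contDiff_η α).isSymmSndFDerivAt (by simp)).eq a b
  -- the derivative of the 2-form `Φ = dη^α` in the direction `a`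
  have key : ∀ a b c, G x b (covEndo G F x a c) - G x (F x b) (christoffelL G x a c)
      + G x (christoffelL G x a b) (F x c) = (1 / 2 : ℝ) *
        (fderiv ℝ (fderiv ℝ (η α)) x a b c - fderiv ℝ (fderiv ℝ (η α)) x a c b) := by
    intro a b c
    have h1 : (fun y ↦ G y b (F y c)) =ᶠ[𝓝 x]
        fun y ↦ (1 / 2 : ℝ) * (fderiv ℝ (η α) y b c - fderiv ℝ (η α) y c b) := by
      filter_upwards [h.contact, hη] with y hy hy'
      rw [hy α, coordExtDeriv, lieBracket_const, fderiv_apply_const hy', fderiv_apply_const hy']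
      simp
    have h2 := (h.differentiable_G.hasFDerivAt.clm_apply (hasFDerivAt_const b x)).clm_apply
        (h.differentiable_F.hasFDerivAt.clm_apply (hasFDerivAt_const c x))
    have h3 : ∀ b c, HasFDerivAt (fun y ↦ fderiv ℝ (η α) y b c) _ x := fun b c ↦
      (hη'.hasFDerivAt.clm_apply (hasFDerivAt_const b x)).clm_apply (hasFDerivAt_const c x)
    have h4 := congrArg (fun L ↦ L a) (h1.fderiv_eq (𝕜 := ℝ))
    rw [h2.fderiv, (((h3 b c).fun_sub (h3 c b)).const_mul _).fderiv] at h4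
    simp only [add_apply, sub_apply, smul_apply, ContinuousLinearMap.comp_apply,
      ContinuousLinearMap.flip_apply, zero_apply, map_zero, zero_add, smul_eq_mul,
      h.fderiv_G] at h4
    rw [← h4]
    simp only [covEndo_apply, map_add, map_sub, h0.skew]
    ring
  have k1 := key a b c
  have k2 := key b c a
  have k3 := key c a b
  rw [hsymm a b, hsymm a c] at k1
  rw [hsymm c b] at k3
  rw [h.covEndo_skew a b c, h.covEndo_skew b c a, h.covEndo_skew c a b, h0.symm _ a, h0.symm _ b,
    h0.symm _ c]
  rw [h0.symm (F x _)] at k1 k2 k3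
  rw [h.christoffelL_symm b a] at k2
  rw [h.christoffelL_symm c b, h.christoffelL_symm c a] at k3
  linarith

theorem covEndo_ξ (h : IsLocalS G F ξ η ε x) (α : ι) (v : E) :
    covEndo G F x v (ξ α x) = -F x (covVec G (ξ α) x v) := by
  have h1 : (fun y ↦ F y (ξ α y)) =ᶠ[𝓝 x] fun _ ↦ 0 := by
    filter_upwards [h.frame] with y hy using hy.F_ξ α
  have h2 := h.differentiable_F.hasFDerivAt.clm_apply (h.differentiable_ξ α).hasFDerivAt
  have h3 := congrArg (fun L ↦ L v) (h1.fderiv_eq (𝕜 := ℝ))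
  rw [h2.fderiv] at h3
  simp only [add_apply, ContinuousLinearMap.comp_apply, ContinuousLinearMap.flip_apply,
    fderiv_fun_const, Pi.zero_apply, zero_apply] at h3
  rw [covEndo_apply, covVec_apply, h.frame.self_of_nhds.F_ξ, map_zero, map_add,
    eq_neg_of_add_eq_zero_right h3]
  abel

theorem covVec_orth (h : IsLocalS G F ξ η ε x) (α β : ι) (v : E) :
    G x (covVec G (ξ α) x v) (ξ β x) + G x (ξ α x) (covVec G (ξ β) x v) = 0 := by
  have h1 : (fun y ↦ G y (ξ α y) (ξ β y)) =ᶠ[𝓝 x]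
      fun _ ↦ ε α * (if α = β then 1 else 0) := by
    filter_upwards [h.frame] with y hy
    rw [hy.metric_ξ, hy.dual]
  have h2 := (h.differentiable_G.hasFDerivAt.clm_apply
    (h.differentiable_ξ α).hasFDerivAt).clm_apply (h.differentiable_ξ β).hasFDerivAt
  have h3 := congrArg (fun L ↦ L v) (h1.fderiv_eq (𝕜 := ℝ))
  rw [h2.fderiv] at h3
  simp only [add_apply, ContinuousLinearMap.comp_apply, ContinuousLinearMap.flip_apply,
    fderiv_fun_const, Pi.zero_apply, zero_apply, h.fderiv_G] at h3
  simp only [covVec_apply, map_add, add_apply]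
  linarith

/-- The covariant derivatives of the structure tensors satisfy the first order identities of an
`S`-structure. -/
theorem isSJet (h : IsLocalS G F ξ η ε x) [Nonempty ι] :
    IsSJet (G x) (F x) (fun α ↦ ξ α x) (fun α ↦ η α x) ε (covEndo G F x)
      (fun α ↦ covVec G (ξ α) x) where
  toIsMetricFrame := h.frame.self_of_nhds
  contact α v w := by
    rw [h.contact.self_of_nhds α, h.coordExtDeriv_eq, h.fderiv_η, h.fderiv_η,
      h.christoffelL_symm w v]
    ring
  A_skew := h.covEndo_skew
  A_cyc := h.covEndo_cyc
  A_ξ := h.covEndo_ξ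
  normal v w := by
    have h1 := h.normal.self_of_nhds v w
    simp only [← h.contact.self_of_nhds] at h1
    rw [← h1]
    congr 1
    have h0 := h.differentiable_F
    simp only [coordNijenhuis, VectorField.lieBracket, fderiv_apply_const h0,
      map_zero, zero_add, fderiv_fun_const, Pi.zero_apply, zero_apply, zero_sub, sub_zero,
      map_neg]
    simp only [covEndo_apply, map_add, map_sub]
    rw [h.christoffelL_symm v w, h.christoffelL_symm v (F x w), h.christoffelL_symm w (F x v),
      h.christoffelL_symm (F x w) (F x v)]
    abel
  B_orth := h.covVec_orth

/-- The curvature on a characteristic vector field, as the skew part of `∇φ`. The Christoffel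
symbols are differentiated along the identity `∇_v ξ_α = -ε_α φ v`, which holds near `x`. -/
theorem coordCurvature_ξ_eq [CompleteSpace E] (h : IsLocalS G F ξ η ε x) [Nonempty ι] (α : ι)
    (a b : E) :
    coordCurvature G x a b (ξ α x) = -(ε α • (covEndo G F x a b - covEndo G F x b a)) := by
  have hΓ := differentiableAt_christoffelL h.contDiff_G h.invertible
  have hξ' : DifferentiableAt ℝ (fderiv ℝ (ξ α)) x :=
    ((h.contDiff_ξ α).fderiv_right (m := 1) (by norm_num)).differentiableAt (by simp)
  have hsymm : fderiv ℝ (fderiv ℝ (ξ α)) x a b = fderiv ℝ (fderiv ℝ (ξ α)) x b a :=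
    ((h.contDiff_ξ α).isSymmSndFDerivAt (by simp)).eq a b
  have hB : ∀ v, christoffelL G x v (ξ α x) = -(ε α • F x v) - fderiv ℝ (ξ α) x v := by
    intro v
    rw [← h.isSJet.B_eq α v, covVec_apply]
    abel
  have key : ∀ a b, fderiv ℝ (christoffelL G) x a b (ξ α x) =
      -(ε α • fderiv ℝ F x a b) - fderiv ℝ (fderiv ℝ (ξ α)) x a b
        - christoffelL G x b (fderiv ℝ (ξ α) x a) := by
    intro a b
    have h1 : (fun y ↦ christoffelL G y b (ξ α y)) =ᶠ[𝓝 x]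
        fun y ↦ -(ε α • F y b) - fderiv ℝ (ξ α) y b := by
      filter_upwards [h.eventually] with y hy
      rw [← hy.isSJet.B_eq α b, covVec_apply]
      abel
    have h2 := (hΓ.hasFDerivAt.clm_apply (hasFDerivAt_const b x)).clm_apply
      (h.differentiable_ξ α).hasFDerivAt
    have h3 := ((h.differentiable_F.hasFDerivAt.clm_apply
      (hasFDerivAt_const b x)).fun_const_smul (ε α)).fun_neg.fun_sub
      (hξ'.hasFDerivAt.clm_apply (hasFDerivAt_const b x))
    have h4 := congrArg (fun L ↦ L a) (h1.fderiv_eq (𝕜 := ℝ))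
    rw [h2.fderiv, h3.fderiv] at h4
    simp only [add_apply, sub_apply, neg_apply, smul_apply, ContinuousLinearMap.comp_apply,
      ContinuousLinearMap.flip_apply, zero_apply, map_zero, zero_add] at h4
    rw [← h4]
    abel
  rw [coordCurvature_eq_christoffelL h.contDiff_G h.invertible]
  rw [key, key, hB, hB, hsymm, covEndo_apply, covEndo_apply, h.christoffelL_symm b a]
  simp only [map_sub, map_neg, map_smul, smul_sub, smul_add]
  abel

/-- The curvature of an `S`-manifold on a characteristic vector field:
`R(a, b) ξ_α = ε_α (η̃(a) φ² b - η̃(b) φ² a)` with `η̃ = ∑ ε_β η^β`. -/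
theorem coordCurvature_ξ [CompleteSpace E] (h : IsLocalS G F ξ η ε x) [Nonempty ι] (α : ι)
    (a b : E) :
    coordCurvature G x a b (ξ α x) =
      ε α • ((∑ β, ε β * η β x a) • F x (F x b) - (∑ β, ε β * η β x b) • F x (F x a)) := by
  rw [h.coordCurvature_ξ_eq, h.isSJet.A_sub_A, ← smul_neg, neg_sub]

end IsLocalS

end CoordinateJets

/-! ### Lorentzian `S`-manifolds in coordinates -/

section ManifoldCoordinates

variable {E : Type*} [NormedAddCommGroup E] [NormedSpace ℝ E]
  {M : Type*} [TopologicalSpace M] [ChartedSpace E M] [IsManifold 𝓘(ℝ, E) ∞ M]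

theorem frame_coframe_of_mem {p : M} {x : E} (hx : x ∈ (extChartAt 𝓘(ℝ, E) p).target)
    (v : TangentSpace 𝓘(ℝ, E) ((extChartAt 𝓘(ℝ, E) p).symm x)) :
    frame p _ (coframe p _ v) = v := by
  have := (extChartAt 𝓘(ℝ, E) p).map_target hx
  exact Trivialization.symmL_continuousLinearMapAt _ (by simpa using this) v

theorem coframe_frame_of_mem {p : M} {x : E} (hx : x ∈ (extChartAt 𝓘(ℝ, E) p).target) (v : E) :
    coframe p ((extChartAt 𝓘(ℝ, E) p).symm x) (frame p _ v) = v := by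
  have := (extChartAt 𝓘(ℝ, E) p).map_target hx
  exact Trivialization.continuousLinearMapAt_symmL _ (by simpa using this) v

theorem coordEndo_center (φ : ∀ q : M, TangentSpace 𝓘(ℝ, E) q →L[ℝ] TangentSpace 𝓘(ℝ, E) q)
    (p : M) (v : E) :
    coordEndo φ p (extChartAt 𝓘(ℝ, E) p p) v = coframe p p (φ p (frame p p v)) := by
  have h : ∀ q, q = p → coframe p q (φ q (frame p q v)) = coframe p p (φ p (frame p p v)) := by
    rintro q rfl; rfl
  exact h _ (extChartAt_to_inv p)

theorem coordForm_center (η : ∀ q : M, TangentSpace 𝓘(ℝ, E) q →L[ℝ] ℝ) (p : M) (v : E) :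
    coordForm η p (extChartAt 𝓘(ℝ, E) p p) v = η p (frame p p v) := by
  have h : ∀ q, q = p → η q (frame p q v) = η p (frame p p v) := by
    rintro q rfl; rfl
  exact h _ (extChartAt_to_inv p)

theorem coordVec_center (ξ : ∀ q : M, TangentSpace 𝓘(ℝ, E) q) (p : M) :
    coordVec ξ p (extChartAt 𝓘(ℝ, E) p p) = coframe p p (ξ p) := by
  have h : ∀ q, q = p → coframe p q (ξ q) = coframe p p (ξ p) := by
    rintro q rfl; rfl
  exact h _ (extChartAt_to_inv p)

theorem contMDiffAt_extChartAt_symm_center (p : M) :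
    ContMDiffAt 𝓘(ℝ, E) 𝓘(ℝ, E) ∞ (extChartAt 𝓘(ℝ, E) p).symm (extChartAt 𝓘(ℝ, E) p p) :=
  (contMDiffOn_extChartAt_symm p).contMDiffAt (extChartAt_target_mem_nhds p)

theorem coordEndo_contDiffAt
    {φ : ∀ q : M, TangentSpace 𝓘(ℝ, E) q →L[ℝ] TangentSpace 𝓘(ℝ, E) q}
    (hφ : ContMDiff 𝓘(ℝ, E) (𝓘(ℝ, E).prod 𝓘(ℝ, E →L[ℝ] E)) ∞
      (fun q ↦ TotalSpace.mk' (E →L[ℝ] E)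
        (E := fun q : M ↦ TangentSpace 𝓘(ℝ, E) q →L[ℝ] TangentSpace 𝓘(ℝ, E) q) q (φ q)))
    (p : M) : ContDiffAt ℝ ∞ (coordEndo φ p) (extChartAt 𝓘(ℝ, E) p p) := by
  have h1 := ((contMDiffAt_hom_bundle _).1 (hφ p)).2
  have h3 := ContMDiffAt.comp_of_eq h1 (contMDiffAt_extChartAt_symm_center p)
    (extChartAt_to_inv p)
  exact contMDiffAt_iff_contDiffAt.1 h3

theorem coordForm_contDiffAt {η : ∀ q : M, TangentSpace 𝓘(ℝ, E) q →L[ℝ] ℝ}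
    (hη : ContMDiff 𝓘(ℝ, E) (𝓘(ℝ, E).prod 𝓘(ℝ, E →L[ℝ] ℝ)) ∞
      (fun q ↦ TotalSpace.mk' (E →L[ℝ] ℝ)
        (E := fun q : M ↦ TangentSpace 𝓘(ℝ, E) q →L[ℝ] ℝ) q (η q)))
    (p : M) : ContDiffAt ℝ ∞ (coordForm η p) (extChartAt 𝓘(ℝ, E) p p) := by
  have h1 := ((contMDiffAt_hom_bundle _).1 (hη p)).2
  have h3 := ContMDiffAt.comp_of_eq h1 (contMDiffAt_extChartAt_symm_center p)
    (extChartAt_to_inv p)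
  refine (contMDiffAt_iff_contDiffAt.1 h3).congr_of_eventuallyEq (.of_forall fun x ↦ ?_)
  ext v
  simp [ContinuousLinearMap.inCoordinates, coordForm]
  rfl

theorem coordVec_contDiffAt {ξ : ∀ q : M, TangentSpace 𝓘(ℝ, E) q}
    (hξ : ContMDiff 𝓘(ℝ, E) (𝓘(ℝ, E).prod 𝓘(ℝ, E)) ∞
      (fun q ↦ TotalSpace.mk' E (E := fun q : M ↦ TangentSpace 𝓘(ℝ, E) q) q (ξ q)))
    (p : M) : ContDiffAt ℝ ∞ (coordVec ξ p) (extChartAt 𝓘(ℝ, E) p p) := by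
  have h1 := (contMDiffAt_section p).1 (hξ p)
  have h3 := ContMDiffAt.comp_of_eq h1 (contMDiffAt_extChartAt_symm_center p)
    (extChartAt_to_inv p)
  refine (contMDiffAt_iff_contDiffAt.1 h3).congr_of_eventuallyEq ?_
  filter_upwards [extChartAt_target_mem_nhds p] with x hx
  have hq : (extChartAt 𝓘(ℝ, E) p).symm x ∈
      (trivializationAt E (TangentSpace 𝓘(ℝ, E)) p).baseSet := by
    have := (extChartAt 𝓘(ℝ, E) p).map_target hx
    simpa using this
  exact congrFun (Trivialization.coe_linearMapAt_of_mem _ hq) _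

variable [FiniteDimensional ℝ E]

/-- In a Lorentzian vector space the orthogonal complement of a timelike vector is positive
definite. -/
theorem LorentzMetric.pos_of_orth_timelike (g : LorentzMetric E M) {q : M}
    {u v : TangentSpace 𝓘(ℝ, E) q} (hu : g.form q u u < 0) (huv : g.form q u v = 0)
    (hv : v ≠ 0) : 0 < g.form q v v := by
  obtain ⟨z, -, hz⟩ := g.lorentz q
  have ha : g.form q z u ≠ 0 := by
    intro h0
    have hu0 : u ≠ 0 := by
      rintro rfl; simp at hu
    linarith [hz u h0 hu0]
  by_cases hb : g.form q z v = 0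
  · exact hz v hb hv
  -- this combination is orthogonal to `z`
  set w := g.form q z v • u - g.form q z u • v with hw
  have hzw : g.form q z w = 0 := by
    simp only [hw, map_sub, map_smul, smul_eq_mul]; ring
  have hww : g.form q w w =
      g.form q z v ^ 2 * g.form q u u + g.form q z u ^ 2 * g.form q v v := by
    simp only [hw, map_sub, map_smul, smul_eq_mul, sub_apply, smul_apply, huv, g.symm q v u]
    ring
  have hw0 : 0 ≤ g.form q w w := by
    by_cases h0 : w = 0
    · simp [h0]
    · exact (hz w hzw h0).le
  have h1 : g.form q z v ^ 2 * g.form q u u < 0 := mul_neg_of_pos_of_neg (by positivity) hu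
  have h2 : 0 < g.form q z u ^ 2 * g.form q v v := by linarith
  exact pos_of_mul_pos_right h2 (by positivity)

/-- The signs `ε_α = g(ξ_α, ξ_α)` of the characteristic vector fields. -/
def causalSign (s : ℕ) [NeZero s] (α : Fin s) : ℝ := if α = 0 then -1 else 1

namespace IsLorentzSManifold

variable {s : ℕ} [NeZero s] {g : LorentzMetric E M} {S : FramedStructure E M s}

theorem skew (h : IsLorentzSManifold g S) (q : M) (v w : TangentSpace 𝓘(ℝ, E) q) :
    g.form q (S.φ q v) w = -g.form q v (S.φ q w) := by
  have key : ∀ v w : TangentSpace 𝓘(ℝ, E) q, g.form q v (S.φ q w) =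
      coordExtDeriv (coordForm (S.η 0) q) (extChartAt 𝓘(ℝ, E) q q)
        (coframe q q v) (coframe q q w) := by
    intro v w
    rw [← h.contact q _ (mem_extChartAt_target q), g.coord_center, coordEndo_center,
      frame_coframe, frame_coframe, frame_coframe]
  rw [g.symm, key, key]
  simp only [coordExtDeriv, lieBracket_const, map_zero]
  ring

theorem metric_ξ' (h : IsLorentzSManifold g S) (q : M) (α : Fin s)
    (v : TangentSpace 𝓘(ℝ, E) q) :
    g.form q (S.ξ α q) v = g.form q (S.ξ α q) (S.ξ α q) * S.η α q v := by
  have h1 := h.compatible q v (S.ξ α q)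
  rw [h.skew, S.φ_φ] at h1
  simp [S.η_ξ] at h1
  rw [g.symm q _ v]
  linarith

theorem metric_ξ_ξ (h : IsLorentzSManifold g S) (q : M) (α : Fin s) :
    g.form q (S.ξ α q) (S.ξ α q) = causalSign s α := by
  unfold causalSign
  split_ifs with hα
  · rw [hα, h.timelike]
  · have h1 : g.form q (S.ξ 0 q) (S.ξ α q) = 0 := by
      rw [h.metric_ξ', S.η_ξ, if_neg (Ne.symm hα), mul_zero]
    have h2 : S.ξ α q ≠ 0 := by
      intro h0
      have := S.η_ξ α α q
      simp [h0] at this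
    have h3 := g.pos_of_orth_timelike (by rw [h.timelike]; norm_num) h1 h2
    rcases h.unit α q with h4 | h4
    · exact h4
    · rw [h4] at h3; norm_num at h3

/-- The characteristic vectors are in the kernel of `φ`: the vectors `φ ξ_α` are null, and they are
orthogonal to the timelike vector `ξ_1`. -/
theorem φ_ξ (h : IsLorentzSManifold g S) (q : M) (α : Fin s) : S.φ q (S.ξ α q) = 0 := by
  have hsq : ∀ α, S.φ q (S.φ q (S.ξ α q)) = 0 := by
    intro α
    rw [S.φ_φ]
    simp [S.η_ξ]
  have hnull : ∀ α, g.form q (S.φ q (S.ξ α q)) (S.φ q (S.ξ α q)) = 0 := by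
    intro α
    rw [h.skew, hsq]
    simp
  have key : ∀ α, g.form q (S.ξ 0 q) (S.φ q (S.ξ α q)) = 0 → S.φ q (S.ξ α q) = 0 := by
    intro α h0
    by_contra hne
    have := g.pos_of_orth_timelike (by rw [h.timelike]; norm_num) h0 hne
    rw [hnull] at this
    exact lt_irrefl _ this
  have h0 : S.φ q (S.ξ 0 q) = 0 := by
    refine key 0 ?_
    have h1 := h.skew q (S.ξ 0 q) (S.ξ 0 q)
    rw [g.symm] at h1
    linarith
  refine key α ?_
  have h1 := h.skew q (S.ξ 0 q) (S.ξ α q)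
  rw [h0] at h1
  simpa using h1

theorem isMetricFrame (h : IsLorentzSManifold g S) (q : M) :
    IsMetricFrame (g.form q) (S.φ q) (fun α ↦ S.ξ α q) (fun α ↦ S.η α q) (causalSign s) where
  symm := g.symm q
  nondeg := g.nondegenerate q
  sq := S.φ_φ q
  dual α β := S.η_ξ α β q
  metric_ξ α v := by rw [h.metric_ξ', h.metric_ξ_ξ]
  skew := h.skew q
  F_ξ := h.φ_ξ q
  ε_sq α := by unfold causalSign; split_ifs <;> norm_num

theorem isLocalS (h : IsLorentzSManifold g S) (p : M) :
    IsLocalS (g.coord p) (coordEndo S.φ p) (fun α ↦ coordVec (S.ξ α) p)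
      (fun α ↦ coordForm (S.η α) p) (causalSign s) (extChartAt 𝓘(ℝ, E) p p) where
  contDiff_G := (g.coord_contDiffAt p).of_le (by norm_cast)
  contDiff_F := (coordEndo_contDiffAt S.smooth_φ p).of_le (by norm_cast)
  contDiff_ξ α := (coordVec_contDiffAt (S.smooth_ξ α) p).of_le (by norm_cast)
  contDiff_η α := (coordForm_contDiffAt (S.smooth_η α) p).of_le (by norm_cast)
  symm := g.coord_symm p
  invertible := g.coord_isInvertible p
  frame := by
    filter_upwards [extChartAt_target_mem_nhds p] with x hx
    have h0 := h.isMetricFrame ((extChartAt 𝓘(ℝ, E) p).symm x)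
    have hG : ∀ v w, g.coord p x v w = g.form _ (frame p _ v) (frame p _ w) := fun _ _ ↦ rfl
    have hF : ∀ v, coordEndo S.φ p x v = coframe p _ (S.φ _ (frame p _ v)) := fun _ ↦ rfl
    have hξ : ∀ α, coordVec (S.ξ α) p x = coframe p _ (S.ξ α _) := fun _ ↦ rfl
    have hη : ∀ α v, coordForm (S.η α) p x v = S.η α _ (frame p _ v) := fun _ _ ↦ rfl
    refine ⟨g.coord_symm p x, fun v hv ↦ ?_, fun v ↦ ?_, fun α β ↦ ?_, fun α v ↦ ?_,
      fun v w ↦ ?_, fun α ↦ ?_, h0.ε_sq⟩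
    · have h1 : frame p _ v = 0 := h0.nondeg _ fun w ↦ by
        rw [← frame_coframe_of_mem hx w, ← hG, hv]
      rw [← coframe_frame_of_mem hx v, h1, map_zero]
    · rw [hF, hF, frame_coframe_of_mem hx, h0.sq, map_add, map_neg, coframe_frame_of_mem hx,
        map_sum]
      simp only [map_smul, hξ, hη]
    · rw [hη, hξ, frame_coframe_of_mem hx, h0.dual]
    · rw [hG, hξ, frame_coframe_of_mem hx, h0.metric_ξ, hη]
    · rw [hG, hG, hF, hF, frame_coframe_of_mem hx, frame_coframe_of_mem hx, h0.skew]
    · rw [hF, hξ, frame_coframe_of_mem hx, h0.F_ξ, map_zero]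
  contact := by
    filter_upwards [extChartAt_target_mem_nhds p] with x hx α v w using h.contact p x hx α v w
  normal := by
    filter_upwards [extChartAt_target_mem_nhds p] with x hx v w using h.normal p x hx v w

/-- The `1`-form `η̃ = ∑ ε_α η^α` at a point. -/
def etaSum (S : FramedStructure E M s) (p : M) : TangentSpace 𝓘(ℝ, E) p →ₗ[ℝ] ℝ :=
  ∑ α, causalSign s α • (S.η α p : TangentSpace 𝓘(ℝ, E) p →ₗ[ℝ] ℝ)

theorem etaSum_apply (S : FramedStructure E M s) (p : M) (v : TangentSpace 𝓘(ℝ, E) p) :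
    etaSum S p v = ∑ α, causalSign s α * S.η α p v := by
  simp [etaSum]

/-- `R(a, b) ξ_α = ε_α (η̃(a) φ² b - η̃(b) φ² a)`. -/
theorem curvature_ξ (h : IsLorentzSManifold g S) (p : M) (α : Fin s)
    (a b : TangentSpace 𝓘(ℝ, E) p) :
    g.curvature p a b (S.ξ α p) = causalSign s α •
      (etaSum S p a • S.φ p (S.φ p b) - etaSum S p b • S.φ p (S.φ p a)) := by
  have : CompleteSpace E := FiniteDimensional.complete ℝ E
  have : Nonempty (Fin s) := ⟨0⟩
  have h1 := (h.isLocalS p).coordCurvature_ξ α (coframe p p a) (coframe p p b)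
  simp only [coordVec_center, coordEndo_center, coordForm_center, frame_coframe] at h1
  rw [LorentzMetric.curvature, h1]
  simp only [map_smul, map_sub, frame_coframe, etaSum_apply]

end IsLorentzSManifold

end ManifoldCoordinates

/-! ### Eigenvalues and characteristic polynomials -/

section Eigenvalues

variable {V W : Type*} [AddCommGroup V] [Module ℝ V] [FiniteDimensional ℝ V]
  [AddCommGroup W] [Module ℝ W] [FiniteDimensional ℝ W]

theorem eigenvalues_eq_iff (f : V →ₗ[ℝ] V) (f' : W →ₗ[ℝ] W) :
    eigenvalues f = eigenvalues f' ↔ f.charpoly = f'.charpoly := by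
  refine ⟨fun h ↦ ?_, fun h ↦ by rw [eigenvalues, eigenvalues, h]⟩
  apply Polynomial.map_injective _ (algebraMap ℝ ℂ).injective
  rw [(IsAlgClosed.splits (f.charpoly.map (algebraMap ℝ ℂ))).eq_prod_roots_of_monic
      (f.charpoly_monic.map _),
    (IsAlgClosed.splits (f'.charpoly.map (algebraMap ℝ ℂ))).eq_prod_roots_of_monic
      (f'.charpoly_monic.map _)]
  exact congrArg (fun m : Multiset ℂ ↦ (m.map fun a ↦ Polynomial.X - Polynomial.C a).prod) h

theorem charpoly_eq_of_intertwining {f : V →ₗ[ℝ] V} {f' : W →ₗ[ℝ] W} (e : V →ₗ[ℝ] W)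
    (he : Function.Bijective e) (h : ∀ v, f' (e v) = e (f v)) : f'.charpoly = f.charpoly := by
  let e' := LinearEquiv.ofBijective e he
  have : f' = e'.conj f := by
    ext w
    obtain ⟨v, rfl⟩ := e'.surjective w
    simp only [LinearEquiv.conj_apply_apply, LinearEquiv.symm_apply_apply]
    exact h v
  rw [this, LinearEquiv.charpoly_conj]

theorem charpoly_add_one_inj (f : V →ₗ[ℝ] V) (f' : W →ₗ[ℝ] W) :
    (f + 1).charpoly = (f' + 1).charpoly ↔ f.charpoly = f'.charpoly := by
  constructor
  · intro h
    have h1 := (f + 1).charpoly_sub_smul 1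
    have h2 := (f' + 1).charpoly_sub_smul 1
    rw [one_smul, add_sub_cancel_right] at h1 h2
    rw [h1, h2, h]
  · intro h
    have h1 := f.charpoly_sub_smul (-1)
    have h2 := f'.charpoly_sub_smul (-1)
    rw [neg_one_smul, sub_neg_eq_add] at h1 h2
    rw [h1, h2, h]

end Eigenvalues

/-! ### Symmetries of the curvature operator -/

section Curvature

variable {E : Type*} [NormedAddCommGroup E] [NormedSpace ℝ E] [FiniteDimensional ℝ E]
  {M : Type*} [TopologicalSpace M] [ChartedSpace E M] [IsManifold 𝓘(ℝ, E) ∞ M]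

namespace LorentzMetric

variable (g : LorentzMetric E M) {p : M}

theorem curvature_swap (a b c : TangentSpace 𝓘(ℝ, E) p) :
    g.curvature p a b c = -g.curvature p b a c := by
  simp only [curvature, coordCurvature_eq, ← map_neg, neg_sub]

theorem curvature_cyc (a b c : TangentSpace 𝓘(ℝ, E) p) :
    g.curvature p a b c + g.curvature p b c a + g.curvature p c a b = 0 := by
  have : CompleteSpace E := FiniteDimensional.complete ℝ E
  simp only [curvature, ← map_add, coordCurvature_cyc (g.coord_symm p)
    ((g.coord_contDiffAt p).of_le (by norm_cast)) (g.coord_isInvertible p), map_zero]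

theorem curvature_add_right (a b c c' : TangentSpace 𝓘(ℝ, E) p) :
    g.curvature p a b (c + c') = g.curvature p a b c + g.curvature p a b c' := by
  have : CompleteSpace E := FiniteDimensional.complete ℝ E
  have hd : ContDiffAt ℝ 2 (g.coord p) (extChartAt 𝓘(ℝ, E) p p) :=
    (g.coord_contDiffAt p).of_le (by norm_cast)
  simp only [curvature, coordCurvature_eq_christoffelL hd (g.coord_isInvertible p), map_add,
    map_sub]
  abel

theorem curvature_add_middle (a b b' c : TangentSpace 𝓘(ℝ, E) p) :
    g.curvature p a (b + b') c = g.curvature p a b c + g.curvature p a b' c := by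
  rw [curvature_swap, curvature_add, neg_add, ← curvature_swap, ← curvature_swap]

theorem curvature_skew' (a b c d : TangentSpace 𝓘(ℝ, E) p) :
    g.form p (g.curvature p a b c) d = -g.form p (g.curvature p a b d) c := by
  have h := g.curvature_skew a b (c + d)
  have h1 := g.curvature_skew a b c
  have h2 := g.curvature_skew a b d
  simp only [curvature_add_right, map_add, add_apply] at h
  linarith

/-- The pair symmetry of the curvature tensor: a signed sum of the four Bianchi identities for
the cyclic permutations of the arguments. -/
theorem curvature_pair (a b c d : TangentSpace 𝓘(ℝ, E) p) :
    g.form p (g.curvature p a b c) d = g.form p (g.curvature p c d a) b := by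
  have key : ∀ a b c d : TangentSpace 𝓘(ℝ, E) p, g.form p (g.curvature p a b c) d
      + g.form p (g.curvature p b c a) d + g.form p (g.curvature p c a b) d = 0 := by
    intro a b c d
    rw [← add_apply, ← map_add, ← add_apply, ← map_add, curvature_cyc]
    simp
  have swap : ∀ a b c d : TangentSpace 𝓘(ℝ, E) p, g.form p (g.curvature p a b c) d
      = -g.form p (g.curvature p b a c) d := by
    intro a b c d
    rw [curvature_swap]; simp
  have k1 := key a b c d
  have k2 := key b c d a
  have k3 := key c d a b
  have k4 := key d a b c
  have e1 := g.curvature_skew' b c d a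
  have e4 := g.curvature_skew' c d b a
  have e5 := g.curvature_skew' d a c b
  have e6 := g.curvature_skew' a b d c
  have s4 := swap b d a c
  have s5 := g.curvature_skew' d b c a
  have s6 := g.curvature_skew' a c d b
  have s7 := swap c a b d
  linarith

end LorentzMetric

/-! ### Jacobi operators of celestial and null vectors -/

namespace IsLorentzSManifold

variable {s : ℕ} [NeZero s] {g : LorentzMetric E M} {S : FramedStructure E M s} {p : M}
  {x : TangentSpace 𝓘(ℝ, E) p}

theorem η_of_mem (h : IsLorentzSManifold g S) (hx : x ∈ phiCelestialSphere g S p) (α : Fin s) :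
    S.η α p x = 0 := by
  obtain ⟨-, y, rfl⟩ := hx
  exact (h.isMetricFrame p).η_F α y

theorem φ_φ_of_mem (h : IsLorentzSManifold g S) (hx : x ∈ phiCelestialSphere g S p) :
    S.φ p (S.φ p x) = -x := by
  simp [S.φ_φ, h.η_of_mem hx]

theorem etaSum_of_mem (h : IsLorentzSManifold g S) (hx : x ∈ phiCelestialSphere g S p) :
    etaSum S p x = 0 := by
  simp [etaSum_apply, h.η_of_mem hx]

theorem etaSum_ξ (S : FramedStructure E M s) (p : M) (α : Fin s) :
    etaSum S p (S.ξ α p) = causalSign s α := by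
  simp [etaSum_apply, S.η_ξ]

theorem form_sum_ξ (h : IsLorentzSManifold g S) (v : TangentSpace 𝓘(ℝ, E) p) :
    g.form p (∑ α, S.ξ α p) v = etaSum S p v := by
  simp [etaSum_apply, (h.isMetricFrame p).metric_ξ]

/-- `R(y, ξ_α) x = -ε_α g(x, y) ∑ ξ_β` for `x` in the `φ`-celestial sphere, dual under the pair
symmetry to the value of the curvature on `ξ_α`. -/
theorem curvature_ξ_mem (h : IsLorentzSManifold g S) (hx : x ∈ phiCelestialSphere g S p)
    (α : Fin s) (y : TangentSpace 𝓘(ℝ, E) p) :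
    g.curvature p y (S.ξ α p) x = -(causalSign s α * g.form p x y) • ∑ β, S.ξ β p := by
  have h0 := h.isMetricFrame p
  refine h0.ext_metric fun z ↦ ?_
  rw [map_smul _ _ (∑ β, S.ξ β p), smul_apply, h.form_sum_ξ, g.curvature_pair,
    g.curvature_skew', h.curvature_ξ, h.etaSum_of_mem hx, h.φ_φ_of_mem hx]
  simp
  ring

theorem jacobiEnd_ξ (h : IsLorentzSManifold g S) (hx : x ∈ phiCelestialSphere g S p)
    (α : Fin s) : g.jacobiEnd x (S.ξ α p) = causalSign s α • ∑ β, S.ξ β p := by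
  change g.curvature p _ _ _ = _
  rw [g.curvature_swap, h.curvature_ξ_mem hx, hx.1.2]
  simp

theorem η_jacobiEnd (h : IsLorentzSManifold g S) (hx : x ∈ phiCelestialSphere g S p)
    {d : TangentSpace 𝓘(ℝ, E) p} (hd : ∀ β, S.η β p d = 0) (α : Fin s) :
    S.η α p (g.jacobiEnd x d) = 0 := by
  have h0 := h.isMetricFrame p
  change S.η α p (g.curvature p d x x) = 0
  rw [h0.η_eq, h0.symm, g.curvature_skew', h.curvature_ξ, h.etaSum_of_mem hx]
  simp [etaSum_apply, hd]

/-- The Jacobi operator of the null vector `u = ξ_1 + x` in terms of that of `x`. -/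
theorem jacobiEnd_null (h : IsLorentzSManifold g S) (hx : x ∈ phiCelestialSphere g S p)
    (y : TangentSpace 𝓘(ℝ, E) p) :
    g.jacobiEnd (S.ξ 0 p + x) y =
      g.jacobiEnd x y + etaSum S p y • x + g.form p x y • ∑ β, S.ξ β p - S.φ p (S.φ p y) := by
  change g.curvature p _ _ _ = g.curvature p _ _ _ + _ + _ - _
  have hs : causalSign s 0 = -1 := by simp [causalSign]
  rw [g.curvature_add_middle, g.curvature_add_right, g.curvature_add_right, h.curvature_ξ,
    h.curvature_ξ_mem hx, h.curvature_ξ, h.φ_φ_of_mem hx, h.etaSum_of_mem hx, etaSum_ξ, hs,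
    h.φ_ξ, map_zero]
  simp
  abel

/-- The orthogonal complement of `x` in the image of `φ_p`, the latter being the common kernel of
the forms `η^α`. -/
def phiOrth (g : LorentzMetric E M) (S : FramedStructure E M s) {p : M}
    (x : TangentSpace 𝓘(ℝ, E) p) : Submodule ℝ (TangentSpace 𝓘(ℝ, E) p) :=
  (⨅ α, LinearMap.ker (S.η α p).toLinearMap) ⊓ g.orth x

omit [NeZero s] in
theorem mem_phiOrth {d : TangentSpace 𝓘(ℝ, E) p} :
    d ∈ phiOrth g S x ↔ (∀ α, S.η α p d = 0) ∧ g.form p x d = 0 := by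
  simp [phiOrth, LorentzMetric.orth, Submodule.mem_iInf]

/-- The restriction of the Jacobi operator `R_x` to the orthogonal complement of `x` in the image
of `φ_p`. -/
def phiJacobi (h : IsLorentzSManifold g S) (hx : x ∈ phiCelestialSphere g S p) :
    phiOrth g S x →ₗ[ℝ] phiOrth g S x :=
  (g.jacobiEnd x).restrict fun d hd ↦
    mem_phiOrth.2 ⟨h.η_jacobiEnd hx (mem_phiOrth.1 hd).1, g.jacobiEnd_mem_orth x d⟩

/-- The action of `R_x` on the span of the characteristic vectors: `ξ_α ↦ ε_α ∑ ξ_β`. -/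
def jacobiFrame (s : ℕ) [NeZero s] : (Fin s → ℝ) →ₗ[ℝ] (Fin s → ℝ) :=
  (∑ α, causalSign s α • LinearMap.proj α).smulRight 1

/-- The action of `R̄_u` on the span of the spacelike characteristic vectors: `ξ_α ↦ ∑ ξ_β`. -/
def nullJacobiFrame (s : ℕ) [NeZero s] :
    ({α : Fin s // α ≠ 0} → ℝ) →ₗ[ℝ] ({α : Fin s // α ≠ 0} → ℝ) :=
  (∑ α, LinearMap.proj α).smulRight 1

theorem jacobiFrame_apply (c : Fin s → ℝ) (β : Fin s) :
    jacobiFrame s c β = ∑ α, causalSign s α * c α := by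
  simp [jacobiFrame]

theorem nullJacobiFrame_apply (c : {α : Fin s // α ≠ 0} → ℝ) (β : {α : Fin s // α ≠ 0}) :
    nullJacobiFrame s c β = ∑ α, c α := by
  simp [nullJacobiFrame]

theorem metric_ξ_of_η (h : IsLorentzSManifold g S) {d : TangentSpace 𝓘(ℝ, E) p}
    (hd : ∀ β, S.η β p d = 0) (α : Fin s) : g.form p (S.ξ α p) d = 0 := by
  rw [(h.isMetricFrame p).metric_ξ, hd, mul_zero]

theorem metric_mem_ξ (h : IsLorentzSManifold g S) (hx : x ∈ phiCelestialSphere g S p)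
    (α : Fin s) : g.form p x (S.ξ α p) = 0 := by
  rw [g.symm, h.metric_ξ_of_η (h.η_of_mem hx)]

/-- `R_x` splits along the sum of the span of the characteristic vectors and the orthogonal
complement of `x` in the image of `φ_p`. -/
theorem charpoly_jacobi (h : IsLorentzSManifold g S) (hx : x ∈ phiCelestialSphere g S p) :
    (g.jacobi x).charpoly = (jacobiFrame s).charpoly * (h.phiJacobi hx).charpoly := by
  have hmem : ∀ d, d ∈ g.orth x ↔ g.form p x d = 0 := fun d ↦ Iff.rfl
  let T : (Fin s → ℝ) × phiOrth g S x →ₗ[ℝ] TangentSpace 𝓘(ℝ, E) p :=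
    (Fintype.linearCombination ℝ fun α ↦ S.ξ α p).coprod (phiOrth g S x).subtype
  have hT : ∀ c, T c = ∑ α, c.1 α • S.ξ α p + (c.2 : TangentSpace 𝓘(ℝ, E) p) := by
    intro c; simp [T, Fintype.linearCombination_apply]
  have hTmem : ∀ c, T c ∈ g.orth x := by
    intro c
    rw [hmem, hT, map_add, (mem_phiOrth.1 c.2.2).2]
    simp [h.metric_mem_ξ hx]
  rw [← LinearMap.charpoly_prodMap]
  refine charpoly_eq_of_intertwining (T.codRestrict _ hTmem) ⟨?_, ?_⟩ fun c ↦ Subtype.ext ?_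
  · rw [← LinearMap.ker_eq_bot, LinearMap.ker_codRestrict, LinearMap.ker_eq_bot']
    intro c hc
    rw [hT] at hc
    have h1 : c.1 = 0 := by
      funext β
      have := congrArg (S.η β p) hc
      simpa [(mem_phiOrth.1 c.2.2).1, S.η_ξ] using this
    have h2 : c.2 = 0 := by
      simpa [h1] using hc
    exact Prod.ext h1 h2
  · rintro ⟨v, hv⟩
    rw [hmem] at hv
    refine ⟨(fun α ↦ S.η α p v, ⟨v - ∑ α, S.η α p v • S.ξ α p, mem_phiOrth.2 ⟨?_, ?_⟩⟩),
      Subtype.ext ?_⟩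
    · intro β
      simp [S.η_ξ]
    · simp [hv, h.metric_mem_ξ hx]
    · change T _ = v
      rw [hT]
      simp
  · change g.jacobiEnd x (T c) = T _
    rw [hT, hT, map_add, map_sum]
    simp only [map_smul, h.jacobiEnd_ξ hx, LinearMap.prodMap_apply, jacobiFrame_apply,
      smul_smul, ← Finset.sum_smul, ← Finset.smul_sum]
    refine congrArg₂ (· + ·) (congrArg₂ (· • ·) ?_ rfl) rfl
    exact Finset.sum_congr rfl fun α _ ↦ mul_comm _ _

theorem sum_eq_add_sum_ne_zero {A : Type*} [AddCommMonoid A] (f : Fin s → A) :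
    ∑ α, f α = f 0 + ∑ α : {α : Fin s // α ≠ 0}, f α := by
  rw [← Fintype.sum_subtype_add_sum_subtype (fun α : Fin s ↦ α = 0) f]
  simp
  rfl

/-- `R̄_u`, for `u = ξ_1 + x`, splits along the span of the spacelike characteristic vectors and the
orthogonal complement of `x` in the image of `φ_p`; on the latter it is `R_x + 1`. -/
theorem charpoly_nullJacobi (h : IsLorentzSManifold g S) (hx : x ∈ phiCelestialSphere g S p) :
    (g.nullJacobi (S.ξ 0 p + x)).charpoly =
      (nullJacobiFrame s).charpoly * (h.phiJacobi hx + 1).charpoly := by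
  set u := S.ξ 0 p + x with hu
  have hmem : ∀ d, d ∈ g.orth u ↔ g.form p (S.ξ 0 p) d + g.form p x d = 0 := fun d ↦ by
    change g.form p u d = 0 ↔ _
    rw [hu, map_add, add_apply]
  have hηu : S.η 0 p u = 1 := by
    simp [hu, h.η_of_mem hx, S.η_ξ]
  let T : ({α : Fin s // α ≠ 0} → ℝ) × phiOrth g S x →ₗ[ℝ] TangentSpace 𝓘(ℝ, E) p :=
    (Fintype.linearCombination ℝ fun α : {α : Fin s // α ≠ 0} ↦ S.ξ α p).coprod
      (phiOrth g S x).subtype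
  have hT : ∀ c, T c = ∑ α, c.1 α • S.ξ α p + (c.2 : TangentSpace 𝓘(ℝ, E) p) := by
    intro c; simp [T, Fintype.linearCombination_apply]
  have hξξ : ∀ α : {α : Fin s // α ≠ 0}, g.form p (S.ξ 0 p) (S.ξ α p) = 0 := by
    intro α
    rw [(h.isMetricFrame p).metric_ξ, S.η_ξ, if_neg (Ne.symm α.2), mul_zero]
  have hTmem : ∀ c, T c ∈ g.orth u := by
    intro c
    rw [hmem, hT, map_add, map_add, (mem_phiOrth.1 c.2.2).2,
      h.metric_ξ_of_η (mem_phiOrth.1 c.2.2).1]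
    simp [h.metric_mem_ξ hx, hξξ]
  have hηT : ∀ c, S.η 0 p (T c) = 0 := by
    intro c
    rw [hT, map_add, (mem_phiOrth.1 c.2.2).1, map_sum, add_zero]
    exact Finset.sum_eq_zero fun α _ ↦ by
      rw [map_smul, S.η_ξ, if_neg (Ne.symm α.2), smul_zero]
  have hmk : ∀ v w : g.orth u, (g.nullLine u).mkQ v = (g.nullLine u).mkQ w ↔
      ∃ r : ℝ, r • u = (v : TangentSpace 𝓘(ℝ, E) p) - w := by
    intro v w
    rw [Submodule.mkQ_apply, Submodule.mkQ_apply, Submodule.Quotient.eq]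
    exact Submodule.mem_span_singleton
  rw [← LinearMap.charpoly_prodMap]
  refine charpoly_eq_of_intertwining ((g.nullLine u).mkQ ∘ₗ T.codRestrict _ hTmem) ⟨?_, ?_⟩
    fun c ↦ ?_
  · rw [injective_iff_map_eq_zero]
    intro c hc
    rw [← map_zero (g.nullLine u).mkQ, LinearMap.comp_apply, hmk] at hc
    obtain ⟨r, hr⟩ := hc
    simp only [LinearMap.codRestrict_apply, Submodule.coe_zero, sub_zero] at hr
    -- the form `η^1` vanishes on the complement and not on `u`
    have hr0 : r = 0 := by
      have := congrArg (S.η 0 p) hr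
      simpa [hηT, hηu] using this
    have hc : T c = 0 := by rw [← hr, hr0, zero_smul]
    rw [hT] at hc
    have h1 : c.1 = 0 := by
      funext β
      have := congrArg (S.η β p) hc
      simpa [(mem_phiOrth.1 c.2.2).1, S.η_ξ, ← Subtype.ext_iff] using this
    have h2 : c.2 = 0 := by
      simpa [h1] using hc
    exact Prod.ext h1 h2
  · intro q
    obtain ⟨⟨v, hv⟩, rfl⟩ := (g.nullLine u).mkQ_surjective q
    -- the representative of the class of `v` in the complement is `v - η^1(v) u`
    rw [hmem] at hv
    have h0v : g.form p x v = S.η 0 p v := by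
      have := (h.isMetricFrame p).metric_ξ 0 v
      simp only [causalSign, if_true] at this
      linarith
    refine ⟨(fun α ↦ S.η α p v,
      ⟨v - ∑ α, S.η α p v • S.ξ α p - S.η 0 p v • x, mem_phiOrth.2 ⟨?_, ?_⟩⟩), ?_⟩
    · intro β
      simp [S.η_ξ, h.η_of_mem hx]
    · simp [h.metric_mem_ξ hx, h0v, hx.1.2]
    · rw [LinearMap.comp_apply, hmk]
      refine ⟨-S.η 0 p v, ?_⟩
      have h1 := sum_eq_add_sum_ne_zero fun α ↦ S.η α p v • S.ξ α p
      rw [LinearMap.codRestrict_apply, hT]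
      dsimp only
      rw [h1, hu]
      simp only [smul_add, neg_smul]
      abel
  · change (g.nullLine u).mkQ (g.jacobi u (T.codRestrict _ hTmem c)) = _
    rw [LinearMap.comp_apply, hmk]
    refine ⟨∑ α, c.1 α, ?_⟩
    change _ = g.jacobiEnd u (T c) - T _
    have hd := mem_phiOrth.1 c.2.2
    have hsign : ∀ α : {α : Fin s // α ≠ 0}, causalSign s α = 1 := fun α ↦ if_neg α.2
    have hφ : S.φ p (S.φ p (T c)) = -(c.2 : TangentSpace 𝓘(ℝ, E) p) := by
      rw [hT, map_add, map_sum]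
      simp [h.φ_ξ, S.φ_φ, hd.1]
    have hη : etaSum S p (T c) = ∑ α, c.1 α := by
      rw [hT, map_add, map_sum]
      simp only [map_smul, etaSum_ξ, hsign, smul_eq_mul, mul_one]
      simp [etaSum_apply, hd.1]
    have hx0 : g.form p x (T c) = 0 := by
      rw [hT, map_add, hd.2]
      simp [h.metric_mem_ξ hx]
    have hJ : g.jacobiEnd x (T c) =
        (∑ α, c.1 α) • ∑ β, S.ξ β p + g.jacobiEnd x (c.2 : TangentSpace 𝓘(ℝ, E) p) := by
      rw [hT, map_add, map_sum]
      simp only [map_smul, h.jacobiEnd_ξ hx, hsign, one_smul, Finset.sum_smul]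
    have hT' : T ((nullJacobiFrame s).prodMap (h.phiJacobi hx + 1) c) =
        (∑ α, c.1 α) • ∑ α : {α : Fin s // α ≠ 0}, S.ξ α p
          + (g.jacobiEnd x (c.2 : TangentSpace 𝓘(ℝ, E) p) + c.2) := by
      rw [hT]
      simp only [LinearMap.prodMap_apply, nullJacobiFrame_apply, ← Finset.smul_sum]
      rfl
    rw [hT', hu, h.jacobiEnd_null hx, hJ, hη, hx0, hφ,
      sum_eq_add_sum_ne_zero fun α ↦ S.ξ α p]
    simp only [smul_add, zero_smul]
    abel

end IsLorentzSManifold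

end Curvature

end

end LorentzS

open LorentzS in
theorem proposition3p2 {E : Type*} [NormedAddCommGroup E] [NormedSpace ℝ E] [FiniteDimensional ℝ E]
    {M : Type*} [TopologicalSpace M] [T2Space M] [ConnectedSpace M] [ChartedSpace E M]
    [IsManifold 𝓘(ℝ, E) ∞ M] {n s : ℕ} [NeZero s] (hdim : Module.finrank ℝ E = 2 * n + s)
    (g : LorentzMetric E M) (S : FramedStructure E M s) (hS : IsLorentzSManifold g S) (p : M) :
    IsPhiNullOsserman g S p ↔
      ∀ x ∈ phiCelestialSphere g S p, ∀ y ∈ phiCelestialSphere g S p,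
        eigenvalues (g.jacobi x) = eigenvalues (g.jacobi y) := by
  have hmem : ∀ x ∈ phiCelestialSphere g S p, S.ξ 0 p + x ∈ phiNullCongruence g S p := by
    intro x hx
    have h1 := hS.metric_mem_ξ hx 0
    have h2 := hS.timelike p
    have h3 := hx.1.2
    refine ⟨⟨?_, ?_⟩, by rwa [add_sub_cancel_left]⟩
    · simp only [map_add, add_apply, h1, h2, h3, g.symm p (S.ξ 0 p) x]
      norm_num
    · simp only [map_add, add_apply, h1, h2, add_zero]
  have key : ∀ x (hx : x ∈ phiCelestialSphere g S p) y (hy : y ∈ phiCelestialSphere g S p),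
      eigenvalues (g.nullJacobi (S.ξ 0 p + x)) = eigenvalues (g.nullJacobi (S.ξ 0 p + y)) ↔
        eigenvalues (g.jacobi x) = eigenvalues (g.jacobi y) := by
    intro x hx y hy
    rw [eigenvalues_eq_iff, eigenvalues_eq_iff, hS.charpoly_jacobi hx, hS.charpoly_jacobi hy,
      hS.charpoly_nullJacobi hx, hS.charpoly_nullJacobi hy,
      mul_right_inj' (LinearMap.charpoly_monic _).ne_zero,
      mul_right_inj' (LinearMap.charpoly_monic _).ne_zero, charpoly_add_one_inj]
  constructor
  · intro h x hx y hy
    exact (key x hx y hy).1 (h _ (hmem x hx) _ (hmem y hy))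
  · intro h u hu v hv
    have := (key _ hu.2 _ hv.2).2 (h _ hu.2 _ hv.2)
    rwa [add_sub_cancel, add_sub_cancel] at this
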